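/- Conventions. A multicategory $\mathcal M$ has arrows $f:\langle X_1,\dots,X_n\rangle\to X$ ($n\ge 0$) with identities and associative composition $f(f_1,\dots,f_n)$. A cartesian multicategory is a multicategory $\mathcal M$ in which every mapping $p:\{1,\dots,n\}\to\{1,\dots,m\}$ with $Y_{p(i)}=X_i$ for all $i$ acts as $p:\mathcal M(X_1,\dots,X_n;Z)\to\mathcal M(Y_1,\dots,Y_m;Z)$, functorially in $p$, and compatibly with composition: $f(p_1f_1,\dots,p_nf_n)=(p_1+\cdots+p_n)\,f(f_1,\dots,f_n)$ and $(pf)(f_1,\dots,f_m)=p'\,f(f_{p(1)},\dots,f_{p(n)})$, where $p_1+\cdots+p_n$ acts blockwise and $p'$ sends the $i$-th block identically onto the $p(i)$-th block. An fp-functor is a functor of multicategories commuting with these actions; cartesian multicategories and fp-functors form the category $\mathbf{fpMlt}$. A preadditive category is a category enriched in commutative monoids; with additive functors these form the category $\mathbf{cMonCat}$. For a preadditive category $\mathcal C$, the cartesian multicategory $\mathcal C_\blacktriangleright$ has the objects of $\mathcal C$ and $\mathcal C_\blacktriangleright(X_1,\dots,X_n;X)=\mathcal C(X_1,X)\times\cdots\times\mathcal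 C(X_n,X)$, with the identities of $\mathcal C$, composition $\langle\lambda_i\rangle_i(\langle\mu_{ij}\rangle_j)_i=\langle\lambda_i\mu_{ij}\rangle_{i,j}$ and action $(p\langle\lambda_i\rangle)_j=\sum_{p(i)=j}\lambda_i$. For a cartesian multicategory $\mathcal M$, the category $\mathrm{cMon}(\mathcal M)$ has as objects the commutative monoids in $\mathcal M$, that is, objects $X$ with arrows $m_2:\langle X,X\rangle\to X$ and $m_0:\langle\rangle\to X$ that are associative, unital and commutative, and as arrows the unary arrows $f:X\to Y$ of $\mathcal M$ with $f(m_2)=m_2(f,f)$ and $f(m_0)=m_0$; it is preadditive, $f+g$ being $m_2(f,g)$ followed by the action of $\{1,2\}\to\{1\}$, and $0$ being $m_0$ followed by the action of $\emptyset\to\{1\}$. Both constructions are functorial in the evident way. $\mathbf{Set}_\times$ is the cartesian multicategory of sets with $\mathbf{Set}_\times(X_1,\dots,X_n;X)=\mathbf{Set}(X_1\times\cdots\times X_n,X)$ and $(pf)(y_1,\dots,y_m)=f(y_{p(1)},\dots,y_{p(n)})$. Proposition. The functor $(-)_\blacktriangleright:\mathbf{cMonCat}\to\mathbf{fpMlt}$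 is left adjoint to $\mathrm{cMon}(-):\mathbf{fpMlt}\to\mathbf{cMonCat}$. In particular, for a rig $R$ (a preadditive category with one object, i.e. a semiring), left $R$-modules correspond to fp-functors $R_\blacktriangleright\to\mathbf{Set}_\times$: assigning to an $R$-module $E$ the fp-functor with value $E$ that sends $\langle\lambda_1,\dots,\lambda_n\rangle$ to $(x_1,\dots,x_n)\mapsto\lambda_1x_1+\cdots+\lambda_nx_n$ is a bijection from $R$-modules to fp-functors $R_\blacktriangleright\to\mathbf{Set}_\times$, and $R$-linear maps correspond bijectively to natural transformations between the associated fp-functors. -/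

import Mathlib

open CategoryTheory

universe v v' u u' w r

namespace CartMult

/-! ### Concatenation of finite sequences -/

section Indices

variable {n : ℕ} {k : Fin n → ℕ}

/-- The position, in the concatenation of `n` sequences of lengths `k 0, …, k (n - 1)`,
of the `j`-th entry of the `i`-th sequence (lexicographic order). -/
def join (i : Fin n) (j : Fin (k i)) : Fin (∑ i, k i) := finSigmaFinEquiv ⟨i, j⟩

/-- The index of the block to which a position of the concatenation belongs. -/
def blk (s : Fin (∑ i, k i)) : Fin n := (finSigmaFinEquiv.symm s).1

/-- The index, within its block, of a position of the concatenation. -/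
def pos (s : Fin (∑ i, k i)) : Fin (k (blk s)) := (finSigmaFinEquiv.symm s).2

/-- The concatenation of `n` sequences `X i`. -/
abbrev concat {M : Type u} (X : ∀ i, Fin (k i) → M) (s : Fin (∑ i, k i)) : M := X (blk s) (pos s)

theorem join_blk_pos (s : Fin (∑ i, k i)) : join (blk s) (pos s) = s := by
  simp [join, blk, pos]

@[simp] theorem blk_join (i : Fin n) (j : Fin (k i)) : blk (join i j) = i := by
  simp [join, blk]

/-- `join i j` is at position `j` of block `i`. -/
theorem sigma_join (i : Fin n) (j : Fin (k i)) :
    (⟨blk (join i j), pos (join i j)⟩ : (i : Fin n) × Fin (k i)) = ⟨i, j⟩ := by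
  simp [join, blk, pos]

theorem dep_join {P : ∀ i, Fin (k i) → Sort w} (g : ∀ i j, P i j) (i : Fin n) (j : Fin (k i)) :
    g (blk (join i j)) (pos (join i j)) ≍ g i j := by
  have h := sigma_join i j
  generalize blk (join i j) = a, pos (join i j) = b at *
  cases h
  rfl

theorem dep_join_eq {P : Sort w} (g : ∀ i, Fin (k i) → P) (i : Fin n) (j : Fin (k i)) :
    g (blk (join i j)) (pos (join i j)) = g i j := eq_of_heq (dep_join g i j)

@[simp] theorem concat_join {M : Type u} (X : ∀ i, Fin (k i) → M) (i : Fin n) (j : Fin (k i)) :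
    concat X (join i j) = X i j := dep_join_eq X i j

theorem join_cases {P : Fin (∑ i, k i) → Prop} (h : ∀ i j, P (join i j)) (s) : P s :=
  join_blk_pos s ▸ h _ _

theorem join_inj {i i' : Fin n} {j : Fin (k i)} {j' : Fin (k i')} (h : join i j = join i' j') :
    (⟨i, j⟩ : (i : Fin n) × Fin (k i)) = ⟨i', j'⟩ := finSigmaFinEquiv.injective h

theorem join_val (i : Fin n) (j : Fin (k i)) :
    (join i j : ℕ) = ∑ a ∈ Finset.univ.filter (fun a : Fin n => a < i), k a + j := by
  rw [join, finSigmaFinEquiv_apply]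
  congr 1
  refine Finset.sum_bij (fun a _ => Fin.castLE i.2.le a) ?_ ?_ ?_ ?_
  · intro a _
    simp only [Finset.mem_filter, Finset.mem_univ, true_and]
    exact a.2
  · intro a _ b _ h; simpa using h
  · intro b hb
    have hb' : b < i := by simpa using hb
    exact ⟨⟨b, hb'⟩, by simp, rfl⟩
  · intros; rfl

theorem join_lt_of_lt {i i' : Fin n} (h : i < i') (j : Fin (k i)) (j' : Fin (k i')) :
    join i j < join i' j' := by
  rw [Fin.lt_def, join_val, join_val]
  have h1 : ∑ a ∈ Finset.univ.filter (fun a : Fin n => a < i), k a + k i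
      ≤ ∑ a ∈ Finset.univ.filter (fun a : Fin n => a < i'), k a := by
    rw [add_comm, ← Finset.sum_insert (s := Finset.univ.filter (fun a : Fin n => a < i)) (a := i)
      (f := k) (by simp)]
    refine Finset.sum_le_sum_of_subset ?_
    intro a
    simp only [Finset.mem_insert, Finset.mem_filter, Finset.mem_univ, true_and]
    rintro (rfl | h') <;> order
  have := j.2
  omega

theorem join_lt_of_pos_lt {i : Fin n} {j j' : Fin (k i)} (h : j < j') :
    join i j < join i j' := by
  rw [Fin.lt_def, join_val, join_val]
  have : (j : ℕ) < j' := h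
  omega

/-- A map out of a concatenation is strictly monotone if it is so lexicographically. -/
theorem strictMono_of_join {m : ℕ} {f : Fin (∑ i, k i) → Fin m}
    (h1 : ∀ i i' j j', i < i' → f (join i j) < f (join i' j'))
    (h2 : ∀ i j j', j < j' → f (join i j) < f (join i j')) : StrictMono f := by
  intro s t
  induction s using join_cases with | _ i j
  induction t using join_cases with | _ i' j'
  intro h
  rcases lt_trichotomy i i' with hi | rfl | hi
  · exact h1 _ _ _ _ hi
  · rcases lt_trichotomy j j' with hj | rfl | hj
    · exact h2 _ _ _ hj
    · exact absurd h (lt_irrefl _)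
    · exact absurd h (join_lt_of_pos_lt hj).asymm
  · exact absurd h (join_lt_of_lt hi _ _).asymm

theorem eq_cast_of_strictMono {a b : ℕ} (h : a = b) {f : Fin a → Fin b} (hf : StrictMono f) :
    f = Fin.cast h := by
  subst h
  funext i
  have := Subsingleton.elim
    (hf.orderIsoOfSurjective f (Finite.surjective_of_injective hf.injective)) (OrderIso.refl _)
  exact congrArg (fun e : Fin a ≃o Fin a => e i) this

theorem sum_assoc (l : ∀ i, Fin (k i) → ℕ) :
    ∑ s, l (blk s) (pos s) = ∑ i : Fin n, ∑ j, l i j := by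
  rw [← Fintype.sum_sigma', ← Equiv.sum_comp finSigmaFinEquiv.symm]
  rfl

/-- Concatenation of sequences of sequences is associative, as an identity of positions. -/
theorem join_assoc (l : ∀ i, Fin (k i) → ℕ) (i : Fin n) (j : Fin (k i)) (x : Fin (l i j))
    (x' : Fin (l (blk (join i j)) (pos (join i j)))) (hx : (x : ℕ) = x') :
    Fin.cast (sum_assoc l) (join (k := fun s => l (blk s) (pos s)) (join i j) x')
      = join (k := fun i => ∑ j, l i j) i (join j x) := by
  let f : Fin (∑ s, l (blk s) (pos s)) → Fin (∑ i : Fin n, ∑ j, l i j) := fun s =>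
    join (k := fun i => ∑ j, l i j) (blk (blk s)) (join (pos (blk s)) (pos s))
  have hf' : ∀ i j (x' : Fin (l (blk (join i j)) (pos (join i j)))),
      f (join (k := fun s => l (blk s) (pos s)) (join i j) x')
      = join (k := fun i => ∑ j, l i j) i
        (join j ⟨x', x'.2.trans_le (dep_join_eq l i j).le⟩) := by
    intro i j x'
    have h1 := dep_join_eq (k := fun s => l (blk s) (pos s))
      (fun t y => join (k := fun i => ∑ j, l i j) (blk t) (join (pos t) y)) (join i j) x'
    refine h1.trans ?_
    have h3 : ∀ (p q : (i : Fin n) × Fin (k i)) (h : p = q) (x : Fin (l p.1 p.2)),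
      join (k := fun i => ∑ j, l i j) p.1 (join (k := l p.1) p.2 x)
      = join (k := fun i => ∑ j, l i j) q.1 (join (k := l q.1) q.2 ⟨x, h ▸ x.2⟩) := by
      rintro p q rfl x; rfl
    exact h3 _ _ (sigma_join i j) x'
  have hm : StrictMono f := by
    refine strictMono_of_join ?_ ?_
    · intro s s'
      induction s using join_cases with | _ i j
      induction s' using join_cases with | _ i' j'
      intro x x' h
      rw [hf', hf']
      rcases lt_trichotomy i i' with hi | rfl | hi
      · exact join_lt_of_lt hi _ _
      · rcases lt_trichotomy j j' with hj | rfl | hj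
        · exact join_lt_of_pos_lt (join_lt_of_lt hj _ _)
        · exact absurd h (lt_irrefl _)
        · exact absurd h (join_lt_of_pos_lt hj).asymm
      · exact absurd h (join_lt_of_lt hi _ _).asymm
    · intro s
      induction s using join_cases with | _ i j
      intro x x' h
      rw [hf', hf']
      exact join_lt_of_pos_lt (join_lt_of_pos_lt h)
  rw [← eq_cast_of_strictMono (sum_assoc l) hm, hf']
  congr 2
  exact Fin.ext hx.symm

theorem sigma_assoc (l : ∀ i, Fin (k i) → ℕ) (t : Fin (∑ s, l (blk s) (pos s)))
    (s : Fin (∑ i : Fin n, ∑ j, l i j)) (h : Fin.cast (sum_assoc l) t = s) :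
    (⟨blk (blk t), pos (blk t), pos t⟩ : (i : Fin n) × (j : Fin (k i)) × Fin (l i j))
      = ⟨blk s, blk (pos s), pos (pos s)⟩ := by
  subst h
  induction t using join_cases with | _ q x'
  induction q using join_cases with | _ i j
  have hx : (x' : ℕ) < l i j := x'.2.trans_le (dep_join_eq l i j).le
  rw [join_assoc l i j ⟨x', hx⟩ x' rfl]
  trans (⟨i, j, ⟨x', hx⟩⟩ : (i : Fin n) × (j : Fin (k i)) × Fin (l i j))
  · have h3 : ∀ (p q : (i : Fin n) × Fin (k i)) (h : p = q) (x : Fin (l p.1 p.2)),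
      (⟨p.1, p.2, x⟩ : (i : Fin n) × (j : Fin (k i)) × Fin (l i j)) = ⟨q.1, q.2, x, h ▸ x.2⟩ := by
      rintro p q rfl x; rfl
    refine Eq.trans ?_ (h3 _ _ (sigma_join i j) x')
    exact dep_join_eq (k := fun s => l (blk s) (pos s))
      (P := (i : Fin n) × (j : Fin (k i)) × Fin (l i j))
      (fun t y => ⟨blk t, pos t, y⟩) (join i j) x'
  · refine ((dep_join_eq (k := fun i => ∑ j, l i j)
      (P := (i : Fin n) × (j : Fin (k i)) × Fin (l i j))
      (fun i y => ⟨i, blk y, pos y⟩) i (join j ⟨x', hx⟩)).trans ?_).symm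
    exact dep_join_eq (P := (i : Fin n) × (j : Fin (k i)) × Fin (l i j))
      (fun j y => ⟨i, j, y⟩) j ⟨x', hx⟩

theorem join_one_left {n : ℕ} (i : Fin 1) (j : Fin n) (h : ∑ _ : Fin 1, n = n) :
    Fin.cast h (join (k := fun _ : Fin 1 => n) i j) = j := by
  apply Fin.ext
  rw [Fin.val_cast, join_val]
  simp [Subsingleton.elim i 0]

theorem join_one_right {n : ℕ} (i : Fin n) (j : Fin 1) (h : ∑ _ : Fin n, 1 = n) :
    Fin.cast h (join (k := fun _ : Fin n => 1) i j) = i := by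
  have h0 : StrictMono (fun s : Fin (∑ _ : Fin n, 1) => blk s) := by
    refine strictMono_of_join ?_ ?_
    · intro i i' j j' hi; simpa
    · intro i j j' hj; omega
  have := congrFun (eq_cast_of_strictMono h h0) (join (k := fun _ : Fin n => 1) i j)
  rw [← this]; simp

/-- The map of concatenations that acts as `p i` on the `i`-th block. -/
def sumMap {l : Fin n → ℕ} (p : ∀ i, Fin (k i) → Fin (l i)) (s : Fin (∑ i, k i)) :
    Fin (∑ i, l i) := join (blk s) (p (blk s) (pos s))

/-- The map of concatenations that sends the `i`-th block of the source identically to the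
`p i`-th block of the target. -/
def blockMap {m : ℕ} (k : Fin m → ℕ) (p : Fin n → Fin m) (s : Fin (∑ i, k (p i))) :
    Fin (∑ j, k j) := join (p (blk s)) (pos s)

@[simp] theorem sumMap_join {l : Fin n → ℕ} (p : ∀ i, Fin (k i) → Fin (l i)) (i : Fin n)
    (j : Fin (k i)) : sumMap p (join i j) = join i (p i j) :=
  dep_join_eq (fun i j => join i (p i j)) i j

@[simp] theorem blockMap_join {m : ℕ} (k : Fin m → ℕ) (p : Fin n → Fin m) (i : Fin n)
    (j : Fin (k (p i))) :
    blockMap k p (join (k := fun i => k (p i)) i j) = join (p i) j :=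
  dep_join_eq (k := fun i => k (p i)) (fun i j => join (p i) j) i j

theorem concat_sumMap {M : Type u} {l : Fin n → ℕ} (p : ∀ i, Fin (k i) → Fin (l i))
    {X : ∀ i, Fin (k i) → M} {Y : ∀ i, Fin (l i) → M} (h : ∀ i j, Y i (p i j) = X i j)
    (s : Fin (∑ i, k i)) : concat Y (sumMap p s) = concat X s := by
  rw [sumMap, concat_join, h]

theorem concat_blockMap {M : Type u} {m : ℕ} {k : Fin m → ℕ} (p : Fin n → Fin m)
    (Y : ∀ j, Fin (k j) → M) (s : Fin (∑ i, k (p i))) :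
    concat Y (blockMap k p s) = concat (fun i => Y (p i)) s := by
  rw [blockMap, concat_join]

end Indices

/-! ### Multicategories -/

/-- The data of a multicategory with class of objects `M`. -/
class MulticategoryStruct (M : Type u) where
  /-- The arrows `X 0, …, X (n - 1) ⟶ Y`. -/
  Hom : {n : ℕ} → (Fin n → M) → M → Type v
  /-- The identity arrow `X ⟶ X`. -/
  id : (X : M) → Hom (fun _ : Fin 1 => X) X
  /-- The composite `f (g 0, …, g (n - 1))`. -/
  comp : {n : ℕ} → {Y : Fin n → M} → {Z : M} → {k : Fin n → ℕ} →
    {X : ∀ i, Fin (k i) → M} → Hom Y Z → (∀ i, Hom (X i) (Y i)) → Hom (concat X) Z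

infix:26 " ⟶ₘ " => MulticategoryStruct.Hom

namespace MulticategoryStruct

variable {M : Type u} [MulticategoryStruct.{v} M]

/-- An arrow with codomain `Z`, together with its domain. -/
abbrev Arrow (Z : M) := Σ D : (Σ n : ℕ, Fin n → M), D.2 ⟶ₘ Z

/-- The arrow `f` together with its domain. An equation `arrow f = arrow g` says that `f` and `g`
have the same sequence of objects as domain and are equal. -/
def arrow {n : ℕ} {X : Fin n → M} {Z : M} (f : X ⟶ₘ Z) : Arrow Z := ⟨⟨n, X⟩, f⟩

/-- Change of the domain of an arrow to an equal sequence. -/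
def castDom {n m : ℕ} {X : Fin n → M} {Y : Fin m → M} (h : n = m)
    (hX : ∀ i, Y (Fin.cast h i) = X i) {Z : M} (f : X ⟶ₘ Z) : Y ⟶ₘ Z :=
  cast (by subst h; rw [show X = Y from funext fun i => (hX i).symm]) f

theorem arrow_castDom {n m : ℕ} {X : Fin n → M} {Y : Fin m → M} (h : n = m)
    (hX : ∀ i, Y (Fin.cast h i) = X i) {Z : M} (f : X ⟶ₘ Z) :
    arrow (castDom h hX f) = arrow f := by
  subst h
  obtain rfl : X = Y := funext fun i => (hX i).symm
  rfl

theorem arrow_inj {n : ℕ} {X : Fin n → M} {Z : M} {f g : X ⟶ₘ Z} (h : arrow f = arrow g) :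
    f = g := by
  simpa [arrow] using h

end MulticategoryStruct

open MulticategoryStruct (Arrow arrow castDom arrow_castDom arrow_inj)

/-- Multicategories: composition is unital and associative. -/
class Multicategory (M : Type u) extends MulticategoryStruct.{v} M where
  id_comp : ∀ {n : ℕ} {X : Fin n → M} {Z : M} (f : X ⟶ₘ Z),
    arrow (MulticategoryStruct.comp (MulticategoryStruct.id Z) (fun _ => f)) = arrow f
  comp_id : ∀ {n : ℕ} {X : Fin n → M} {Z : M} (f : X ⟶ₘ Z),
    arrow (MulticategoryStruct.comp f (fun i => MulticategoryStruct.id (X i))) = arrow f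
  assoc : ∀ {n : ℕ} {Y : Fin n → M} {Z : M} {k : Fin n → ℕ} {X : ∀ i, Fin (k i) → M}
    {l : ∀ i, Fin (k i) → ℕ} {W : ∀ i j, Fin (l i j) → M}
    (f : Y ⟶ₘ Z) (g : ∀ i, X i ⟶ₘ Y i) (h : ∀ i j, W i j ⟶ₘ X i j),
    arrow (MulticategoryStruct.comp (MulticategoryStruct.comp f g) (fun s => h (blk s) (pos s)))
      = arrow (MulticategoryStruct.comp f (fun i => MulticategoryStruct.comp (g i) (h i)))

/-- Cartesian multicategories: multicategories with an action of the mappings `p` of finite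
domains over the class of objects (`p : Fin n → Fin m` such that `β ∘ p = α`) on the arrows,
functorial and compatible with composition. -/
class CartesianMulticategory (M : Type u) extends Multicategory.{v} M where
  act : ∀ {n m : ℕ} {α : Fin n → M} {β : Fin m → M} (p : Fin n → Fin m)
    (_ : ∀ i, β (p i) = α i) {Z : M}, α ⟶ₘ Z → β ⟶ₘ Z
  act_id : ∀ {n : ℕ} {α : Fin n → M} {Z : M} (f : α ⟶ₘ Z),
    act (fun i => i) (fun _ => rfl) f = f
  act_act : ∀ {n m l : ℕ} {α : Fin n → M} {β : Fin m → M} {γ : Fin l → M} (p : Fin n → Fin m)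
    (hp : ∀ i, β (p i) = α i) (q : Fin m → Fin l) (hq : ∀ j, γ (q j) = β j) {Z : M}
    (f : α ⟶ₘ Z),
    act q hq (act p hp f) = act (fun i => q (p i)) (fun i => (hq (p i)).trans (hp i)) f
  /-- `f (p₁ f₁, …, pₙ fₙ) = (p₁ + ⋯ + pₙ) (f (f₁, …, fₙ))` -/
  comp_act : ∀ {n : ℕ} {Y : Fin n → M} {Z : M} {k l : Fin n → ℕ} {X : ∀ i, Fin (k i) → M}
    {W : ∀ i, Fin (l i) → M} (f : Y ⟶ₘ Z) (p : ∀ i, Fin (k i) → Fin (l i))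
    (hp : ∀ i j, W i (p i j) = X i j) (g : ∀ i, X i ⟶ₘ Y i),
    MulticategoryStruct.comp f (fun i => act (p i) (hp i) (g i)) = act (sumMap p) (concat_sumMap p hp) (MulticategoryStruct.comp f g)
  /-- `(p f) (g₁, …, gₘ) = p' (f (g_{p 1}, …, g_{p n}))` -/
  act_comp : ∀ {n m : ℕ} {Y : Fin m → M} {Z : M} {k : Fin m → ℕ} {X : ∀ j, Fin (k j) → M}
    (p : Fin n → Fin m) (f : (fun i => Y (p i)) ⟶ₘ Z) (g : ∀ j, X j ⟶ₘ Y j),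
    MulticategoryStruct.comp (act p (fun _ => rfl) f) g
      = act (blockMap k p) (concat_blockMap p X) (MulticategoryStruct.comp f (fun i => g (p i)))

open CartesianMulticategory MulticategoryStruct

/-- Functors of multicategories. -/
structure MultiFunctor (M : Type u) (N : Type u') [Multicategory.{v} M] [Multicategory.{v'} N] where
  obj : M → N
  map : ∀ {n : ℕ} {X : Fin n → M} {Z : M}, X ⟶ₘ Z → (fun i => obj (X i)) ⟶ₘ obj Z
  map_id : ∀ X : M, map (MulticategoryStruct.id X) = MulticategoryStruct.id (obj X)
  map_comp : ∀ {n : ℕ} {Y : Fin n → M} {Z : M} {k : Fin n → ℕ} {X : ∀ i, Fin (k i) → M}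
    (f : Y ⟶ₘ Z) (g : ∀ i, X i ⟶ₘ Y i),
    map (comp f g) = comp (map f) (fun i => map (g i))

/-- Functors of cartesian multicategories: those commuting with the actions. -/
structure FpFunctor (M : Type u) (N : Type u') [CartesianMulticategory.{v} M]
    [CartesianMulticategory.{v'} N] extends MultiFunctor M N where
  map_act : ∀ {n m : ℕ} {α : Fin n → M} {β : Fin m → M} (p : Fin n → Fin m)
    (hp : ∀ i, β (p i) = α i) {Z : M} (f : α ⟶ₘ Z),
    map (act p hp f) = act p (fun i => congrArg obj (hp i)) (map f)

/-- Natural transformations of functors of multicategories. -/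
@[ext]
structure MultiNatTrans {M : Type u} {N : Type u'} [Multicategory.{v} M] [Multicategory.{v'} N]
    (F G : MultiFunctor M N) where
  app : ∀ X : M, (fun _ : Fin 1 => F.obj X) ⟶ₘ (G.obj X)
  naturality : ∀ {n : ℕ} {X : Fin n → M} {Z : M} (f : X ⟶ₘ Z),
    arrow (comp (app Z) (fun _ => F.map f)) = arrow (comp (G.map f) (fun i => app (X i)))

namespace FpFunctor

/-- The identity fp-functor. -/
def id (M : Type u) [CartesianMulticategory.{v} M] : FpFunctor M M where
  obj X := X
  map f := f
  map_id _ := rfl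
  map_comp _ _ := rfl
  map_act _ _ _ _ := rfl

/-- Composition of fp-functors. -/
def comp {M : Type u} {N : Type u'} {L : Type w} [CartesianMulticategory.{v} M]
    [CartesianMulticategory.{v'} N] [CartesianMulticategory.{r} L]
    (F : FpFunctor M N) (G : FpFunctor N L) : FpFunctor M L where
  obj X := G.obj (F.obj X)
  map f := G.map (F.map f)
  map_id X := (congrArg G.map (F.map_id X)).trans (G.map_id _)
  map_comp f g := (congrArg G.map (F.map_comp f g)).trans (G.map_comp _ _)
  map_act p hp _ f := (congrArg G.map (F.map_act p hp f)).trans (G.map_act _ _ _)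

end FpFunctor

/-- Bundled cartesian multicategories. -/
structure FpMlt : Type (max (u + 1) (v + 1)) where
  carrier : Type u
  [str : CartesianMulticategory.{v} carrier]

attribute [instance] FpMlt.str

/-- The category of cartesian multicategories and fp-functors. -/
instance : Category FpMlt.{v, u} where
  Hom M N := FpFunctor M.carrier N.carrier
  id M := FpFunctor.id M.carrier
  comp F G := FpFunctor.comp F G
  id_comp _ := rfl
  comp_id _ := rfl
  assoc _ _ _ := rfl

/-! ### Preadditive categories -/

/-- Categories enriched in commutative monoids. -/
class CMonEnriched (C : Type u) [Category.{v} C] where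
  homAddCommMonoid : ∀ X Y : C, AddCommMonoid (X ⟶ Y)
  add_comp : ∀ {X Y Z : C} (f g : X ⟶ Y) (h : Y ⟶ Z), (f + g) ≫ h = f ≫ h + g ≫ h
  comp_add : ∀ {X Y Z : C} (f : X ⟶ Y) (g h : Y ⟶ Z), f ≫ (g + h) = f ≫ g + f ≫ h
  zero_comp : ∀ {X Y Z : C} (h : Y ⟶ Z), (0 : X ⟶ Y) ≫ h = 0
  comp_zero : ∀ {X Y Z : C} (f : X ⟶ Y), f ≫ (0 : Y ⟶ Z) = 0

attribute [reducible, instance] CMonEnriched.homAddCommMonoid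

/-- Additive functors, that is functors enriched in commutative monoids. -/
structure AddFunctor (C : Type u) (D : Type u') [Category.{v} C] [Category.{v'} D]
    [CMonEnriched C] [CMonEnriched D] extends C ⥤ D where
  map_add : ∀ {X Y : C} (f g : X ⟶ Y), map (f + g) = map f + map g
  map_zero : ∀ X Y : C, map (0 : X ⟶ Y) = 0

/-- Bundled categories enriched in commutative monoids. -/
structure CMonCat : Type (max (u + 1) (v + 1)) where
  carrier : Type u
  [cat : Category.{v} carrier]
  [enriched : CMonEnriched carrier]

attribute [instance] CMonCat.cat CMonCat.enriched

/-- The category of categories enriched in commutative monoids and additive functors. -/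
instance : Category CMonCat.{v, u} where
  Hom C D := AddFunctor C.carrier D.carrier
  id C := { 𝟭 C.carrier with map_add := fun _ _ => rfl, map_zero := fun _ _ => rfl }
  comp F G :=
    { F.toFunctor ⋙ G.toFunctor with
      map_add := fun f g => by
        change G.map (F.map (f + g)) = _
        rw [F.map_add, G.map_add]; rfl
      map_zero := fun X Y => by
        change G.map (F.map 0) = _
        rw [F.map_zero, G.map_zero] }

/-- A rig, seen as a category with one object, is enriched in commutative monoids. -/
instance (R : Type r) [Semiring R] : CMonEnriched (SingleObj R) where
  homAddCommMonoid _ _ := inferInstanceAs (AddCommMonoid R)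
  add_comp f g h := mul_add (h : R) f g
  comp_add f g h := add_mul (g : R) h f
  zero_comp h := mul_zero (M₀ := R) h
  comp_zero f := zero_mul (M₀ := R) f

/-! ### The cartesian multicategory of a preadditive category -/

/-- The class of objects of the discrete cocone multicategory of a category `C`. -/
def DiscreteCocone (C : Type u) : Type u := C

section DiscreteCocone

variable (C : Type u) [Category.{v} C]

/-- An arrow of the discrete cocone multicategory with domain `X 0, …, X (n - 1)` is a sequence
of arrows `X i ⟶ Z` of `C`. -/
instance : MulticategoryStruct.{v} (DiscreteCocone C) where
  Hom {n} X Z := ∀ i : Fin n, @Quiver.Hom C _ (X i) Z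
  id X _ := CategoryStruct.id (obj := C) X
  comp f g s := g (blk s) (pos s) ≫ f (blk s)

variable {C}

theorem cocone_arrow_ext {n m : ℕ} {X : Fin n → DiscreteCocone C} {Y : Fin m → DiscreteCocone C}
    {Z : DiscreteCocone C} (f : X ⟶ₘ Z) (g : Y ⟶ₘ Z) (h : n = m)
    (hX : ∀ i, Y (Fin.cast h i) = X i) (hf : ∀ i, g (Fin.cast h i) ≍ f i) :
    arrow f = arrow g := by
  subst h
  obtain rfl : X = Y := funext fun i => (hX i).symm
  obtain rfl : f = g := funext fun i => (eq_of_heq (hf i)).symm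
  rfl

instance : Multicategory.{v} (DiscreteCocone C) where
  id_comp {n X Z} f := by
    have h : ∑ _ : Fin 1, n = n := by simp
    refine cocone_arrow_ext _ _ h ?_ ?_
    · intro s
      induction s using join_cases with | _ i j
      rw [join_one_left, concat_join]
    · intro s
      induction s using join_cases with | _ i j
      rw [join_one_left]
      have := dep_join (k := fun _ : Fin 1 => n) (fun _ j => @CategoryStruct.comp C _ _ _ _ (f j) (CategoryStruct.id (obj := C) Z)) i j
      refine HEq.trans ?_ this.symm
      exact heq_of_eq (Category.comp_id (obj := C) (f j)).symm
  comp_id {n X Z} f := by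
    have h : ∑ _ : Fin n, 1 = n := by simp
    refine cocone_arrow_ext _ _ h ?_ ?_
    · intro s
      induction s using join_cases with | _ i j
      rw [join_one_right, concat_join]
    · intro s
      induction s using join_cases with | _ i j
      rw [join_one_right]
      have := dep_join (k := fun _ : Fin n => 1) (fun i j => @CategoryStruct.comp C _ _ _ _ (CategoryStruct.id (obj := C) (X i)) (f i)) i j
      refine HEq.trans ?_ this.symm
      exact heq_of_eq (Category.id_comp (obj := C) (f i)).symm
  assoc {n Y Z k X l W} f g h := by
    refine cocone_arrow_ext _ _ (sum_assoc l) ?_ ?_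
    · intro t
      exact (congrArg (fun z : (i : Fin n) × (j : Fin (k i)) × Fin (l i j) => W z.1 z.2.1 z.2.2)
        (sigma_assoc l t _ rfl)).symm
    · intro t
      refine (heq_of_eq (Category.assoc (obj := C) (h _ _ _) (g _ _) (f _))).trans ?_
      exact congr_arg_heq (fun z : (i : Fin n) × (j : Fin (k i)) × Fin (l i j) =>
        @CategoryStruct.comp C _ _ _ _ (h z.1 z.2.1 z.2.2)
          (@CategoryStruct.comp C _ _ _ _ (g z.1 z.2.1) (f z.1))) (sigma_assoc l t _ rfl).symm

theorem eqToHom_dep_join {n : ℕ} {k : Fin n → ℕ} {X : ∀ i, Fin (k i) → C} {Z : C}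
    (f : ∀ i j, X i j ⟶ Z) (i : Fin n) (j : Fin (k i)) {A : C} (h : A = concat X (join i j)) :
    eqToHom h ≫ f (blk (join i j)) (pos (join i j))
      = eqToHom (h.trans (concat_join X i j)) ≫ f i j := by
  have := sigma_join i j
  have key : ∀ (p q : (i : Fin n) × Fin (k i)) (_ : p = q) (h1 : A = X p.1 p.2)
      (h2 : A = X q.1 q.2), eqToHom h1 ≫ f p.1 p.2 = eqToHom h2 ≫ f q.1 q.2 := by
    rintro p q rfl h1 h2; rfl
  exact key _ _ this h (h.trans (concat_join X i j))

variable [CMonEnriched C]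

theorem comp_sum {ι : Type*} (s : Finset ι) {X Y Z : C} (f : X ⟶ Y) (g : ι → (Y ⟶ Z)) :
    f ≫ ∑ i ∈ s, g i = ∑ i ∈ s, f ≫ g i := by
  classical
  induction s using Finset.induction_on with
  | empty => simp [CMonEnriched.comp_zero]
  | insert a s ha ih => simp [Finset.sum_insert ha, CMonEnriched.comp_add, ih]

theorem sum_comp {ι : Type*} (s : Finset ι) {X Y Z : C} (f : ι → (X ⟶ Y)) (g : Y ⟶ Z) :
    (∑ i ∈ s, f i) ≫ g = ∑ i ∈ s, f i ≫ g := by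
  classical
  induction s using Finset.induction_on with
  | empty => simp [CMonEnriched.zero_comp]
  | insert a s ha ih => simp [Finset.sum_insert ha, CMonEnriched.add_comp, ih]

/-- The action of `p : Fin n → Fin m` on sequences of arrows: the `j`-th entry of the result is the
sum of the entries `f i` with `p i = j`. -/
def sumAlong {n m : ℕ} {X : Fin n → C} {Y : Fin m → C} (p : Fin n → Fin m)
    (hp : ∀ i, Y (p i) = X i) {Z : C} (f : ∀ i, X i ⟶ Z) (j : Fin m) : Y j ⟶ Z :=
  ∑ i, if h : p i = j then eqToHom ((congrArg Y h.symm).trans (hp i)) ≫ f i else 0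

theorem sumAlong_id {n : ℕ} {X : Fin n → C} {Z : C} (f : ∀ i, X i ⟶ Z) :
    sumAlong (fun i => i) (fun _ => rfl) f = f := by
  funext j
  rw [sumAlong, Finset.sum_eq_single j]
  · simp
  · intro i _ hi; rw [dif_neg hi]
  · simp

theorem sumAlong_sumAlong {n m l : ℕ} {X : Fin n → C} {Y : Fin m → C} {W : Fin l → C}
    (p : Fin n → Fin m) (hp : ∀ i, Y (p i) = X i) (q : Fin m → Fin l) (hq : ∀ j, W (q j) = Y j)
    {Z : C} (f : ∀ i, X i ⟶ Z) :
    sumAlong q hq (sumAlong p hp f)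
      = sumAlong (fun i => q (p i)) (fun i => (hq (p i)).trans (hp i)) f := by
  funext c
  simp only [sumAlong]
  have h1 : ∀ b, (if h : q b = c then eqToHom ((congrArg W h.symm).trans (hq b)) ≫
      (∑ i, if h : p i = b then eqToHom ((congrArg Y h.symm).trans (hp i)) ≫ f i else 0) else 0)
      = ∑ i, if h : q b = c ∧ p i = b then
        eqToHom (by rw [← h.1, hq, ← h.2, hp]) ≫ f i else (0 : W c ⟶ Z) := by
    intro b
    by_cases hb : q b = c
    · rw [dif_pos hb, comp_sum]
      refine Finset.sum_congr rfl fun i _ => ?_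
      by_cases hi : p i = b
      · rw [dif_pos hi, dif_pos ⟨hb, hi⟩, ← Category.assoc, eqToHom_trans]
      · rw [dif_neg hi, dif_neg (fun h => hi h.2), CMonEnriched.comp_zero]
    · rw [dif_neg hb]
      exact (Finset.sum_eq_zero fun i _ => dif_neg fun h => hb h.1).symm
  rw [Finset.sum_congr rfl fun b _ => h1 b, Finset.sum_comm]
  refine Finset.sum_congr rfl fun i _ => ?_
  rw [Finset.sum_eq_single (p i)]
  · by_cases h : q (p i) = c
    · rw [dif_pos h, dif_pos ⟨h, rfl⟩]
    · rw [dif_neg h, dif_neg fun h' => h h'.1]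
  · intro b _ hb
    exact dif_neg fun h => hb h.2.symm
  · simp

theorem sum_join {A : Type*} [AddCommMonoid A] {n : ℕ} {k : Fin n → ℕ} (F : Fin (∑ i, k i) → A) :
    ∑ s, F s = ∑ i, ∑ j, F (join i j) := by
  rw [← Equiv.sum_comp finSigmaFinEquiv, Fintype.sum_sigma]
  rfl

theorem comp_sumAlong {n : ℕ} {Y : Fin n → C} {Z : C} {k l : Fin n → ℕ}
    {X : ∀ i, Fin (k i) → C} {W : ∀ i, Fin (l i) → C} (f : ∀ i, Y i ⟶ Z)
    (p : ∀ i, Fin (k i) → Fin (l i)) (hp : ∀ i j, W i (p i j) = X i j)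
    (g : ∀ i j, X i j ⟶ Y i) (s : Fin (∑ i, l i)) :
    sumAlong (p (blk s)) (hp (blk s)) (g (blk s)) (pos s) ≫ f (blk s)
      = sumAlong (sumMap p) (concat_sumMap p hp) (fun t => g (blk t) (pos t) ≫ f (blk t)) s := by
  simp only [sumAlong]
  rw [sum_join, Finset.sum_eq_single (blk s), sum_comp]
  · refine Finset.sum_congr rfl fun j _ => ?_
    by_cases h : p (blk s) j = pos s
    · have h' : sumMap p (join (blk s) j) = s := by rw [sumMap_join, h, join_blk_pos]
      rw [dif_pos h, dif_pos h', Category.assoc]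
      exact (eqToHom_dep_join (fun i j => g i j ≫ f i) (blk s) j _).symm
    · have h' : sumMap p (join (blk s) j) ≠ s := by
        rw [sumMap_join]
        intro h'
        exact h (by simpa using join_inj (h'.trans (join_blk_pos s).symm))
      rw [dif_neg h, dif_neg h', CMonEnriched.zero_comp]
  · intro i _ hi
    refine Finset.sum_eq_zero fun j _ => dif_neg fun h => hi ?_
    rw [sumMap_join] at h
    rw [← h, blk_join]
  · simp

theorem sumAlong_comp {n m : ℕ} {Y : Fin m → C} {Z : C} {k : Fin m → ℕ}
    {X : ∀ j, Fin (k j) → C} (p : Fin n → Fin m) (f : ∀ i, Y (p i) ⟶ Z)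
    (g : ∀ j i, X j i ⟶ Y j) (s : Fin (∑ j, k j)) :
    g (blk s) (pos s) ≫ sumAlong p (fun _ => rfl) f (blk s)
      = sumAlong (blockMap k p) (concat_blockMap p X)
          (fun t => g (p (blk t)) (pos t) ≫ f (blk t)) s := by
  simp only [sumAlong]
  rw [sum_join, comp_sum]
  refine Finset.sum_congr rfl fun i _ => ?_
  by_cases h : p i = blk s
  · obtain ⟨b, rfl⟩ : ∃ b, s = join (p i) b := by
      have : ∀ (a : Fin m) (b : Fin (k a)) (_ : p i = a), ∃ b', join a b = join (p i) b' := by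
        rintro a b rfl; exact ⟨b, rfl⟩
      obtain ⟨b, hb⟩ := this (blk s) (pos s) h
      exact ⟨b, (join_blk_pos s).symm.trans hb⟩
    rw [dif_pos h, Finset.sum_eq_single b, dif_pos (blockMap_join k p i b)]
    · rw [eqToHom_dep_join (fun i j => g (p i) j ≫ f i) i b]
      have key : ∀ (q : (j : Fin m) × Fin (k j)) (_ : q = ⟨p i, b⟩) (h1 : Y q.1 = Y (p i))
          (h2 : X q.1 q.2 = X (p i) b),
          g q.1 q.2 ≫ eqToHom h1 ≫ f i = eqToHom h2 ≫ g (p i) b ≫ f i := by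
        rintro q rfl h1 h2; simp
      exact key _ (sigma_join (p i) b) _ _
    · intro j _ hj
      refine dif_neg fun h' => hj ?_
      rw [blockMap_join] at h'
      simpa using join_inj h'
    · simp
  · rw [dif_neg h, CMonEnriched.comp_zero]
    refine (Finset.sum_eq_zero fun j _ => dif_neg fun h' => h ?_).symm
    rw [blockMap_join] at h'
    rw [← h', blk_join]

instance : CartesianMulticategory.{v} (DiscreteCocone C) where
  act p hp _ f := sumAlong (C := C) p hp f
  act_id f := sumAlong_id (C := C) f
  act_act p hp q hq _ f := sumAlong_sumAlong (C := C) p hp q hq f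
  comp_act f p hp g := funext fun s => comp_sumAlong (C := C) f p hp g s
  act_comp p f g := funext fun s => sumAlong_comp (C := C) p f g s

end DiscreteCocone

/-! ### The cartesian multicategory of sets -/

/-- `Set_×`: arrows are functions of several variables. -/
instance : MulticategoryStruct.{w} (Type w) where
  Hom {n} X Z := (∀ i : Fin n, X i) → Z
  id _ x := x 0
  comp {_ _ _ _ X} f g x := f fun i => g i fun j => cast (concat_join X i j) (x (join i j))

theorem set_arrow_ext {n m : ℕ} {X : Fin n → Type w} {Y : Fin m → Type w}
    {Z : Type w} (f : X ⟶ₘ Z) (g : Y ⟶ₘ Z) (h : n = m)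
    (hX : ∀ i, Y (Fin.cast h i) = X i) (hf : ∀ (x : ∀ i, X i) (y : ∀ i, Y i),
      (∀ i, y (Fin.cast h i) ≍ x i) → f x = g y) :
    arrow f = arrow g := by
  subst h
  obtain rfl : X = Y := funext fun i => (hX i).symm
  obtain rfl : f = g := funext fun x => hf x x fun _ => HEq.rfl
  rfl

instance : Multicategory.{w} (Type w) where
  id_comp {n X Z} f := by
    have h : ∑ _ : Fin 1, n = n := by simp
    refine set_arrow_ext _ _ h ?_ ?_
    · intro s
      induction s using join_cases with | _ i j
      rw [join_one_left, concat_join]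
    · intro x y hxy
      change f _ = f _
      congr 1
      funext j
      apply eq_of_heq
      refine (cast_heq _ _).trans ?_
      have := hxy (join 0 j)
      rw [join_one_left] at this
      exact this.symm
  comp_id {n X Z} f := by
    have h : ∑ _ : Fin n, 1 = n := by simp
    refine set_arrow_ext _ _ h ?_ ?_
    · intro s
      induction s using join_cases with | _ i j
      rw [join_one_right, concat_join]
    · intro x y hxy
      change f _ = f _
      congr 1
      funext i
      apply eq_of_heq
      refine (cast_heq _ _).trans ?_
      have := hxy (join i 0)
      rw [join_one_right] at this
      exact this.symm
  assoc {n Y Z k X l W} f g h := by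
    refine set_arrow_ext _ _ (sum_assoc l) ?_ ?_
    · intro t
      exact (congrArg (fun z : (i : Fin n) × (j : Fin (k i)) × Fin (l i j) => W z.1 z.2.1 z.2.2)
        (sigma_assoc l t _ rfl)).symm
    · intro x y hxy
      refine congrArg f (funext fun i => congrArg (g i) (funext fun j => eq_of_heq ?_))
      refine (cast_heq _ _).trans ?_
      have key : ∀ (p : (i : Fin n) × Fin (k i)) (_ : p = ⟨i, j⟩) (v : ∀ x, W p.1 p.2 x)
          (u : ∀ x, W i j x) (_ : ∀ (x' : Fin (l p.1 p.2)) (x : Fin (l i j)), (x : ℕ) = (x' : ℕ) → v x' ≍ u x), h p.1 p.2 v ≍ h i j u := by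
        rintro p rfl v u hvu
        rw [show v = u from funext fun x => eq_of_heq (hvu x x rfl)]
      refine key _ (sigma_join i j) _ _ ?_
      intro x' z hz
      refine (cast_heq _ _).trans ?_
      refine HEq.trans ?_ (cast_heq _ _).symm
      refine HEq.trans ?_ (cast_heq _ _).symm
      rw [← join_assoc l i j z x' hz]
      exact (hxy _).symm

instance : CartesianMulticategory.{w} (Type w) where
  act p hp _ f y := f fun i => cast (hp i) (y (p i))
  act_id f := rfl
  act_act p hp q hq Z f := by
    funext z
    simp
  comp_act {n Y Z k l X W} f p hp g := by
    funext x
    refine congrArg f (funext fun i => congrArg (g i) (funext fun j => eq_of_heq ?_))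
    refine (cast_heq _ _).trans ((cast_heq _ _).trans ?_)
    refine HEq.symm ((cast_heq _ _).trans ((cast_heq _ _).trans ?_))
    rw [sumMap_join]
  act_comp {n m Y Z k X} p f g := by
    funext x
    refine congrArg f (funext fun i => congrArg (g (p i)) (funext fun j => eq_of_heq ?_))
    refine (cast_heq _ _).trans ?_
    refine HEq.symm ((cast_heq _ _).trans ((cast_heq _ _).trans ?_))
    rw [blockMap_join]

/-! ### Simultaneous substitution in a cartesian multicategory -/

section Substitution

variable {M : Type u} [CartesianMulticategory.{v} M]

theorem act_congr {n m : ℕ} {α : Fin n → M} {β : Fin m → M} {p q : Fin n → Fin m}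
    (hp : ∀ i, β (p i) = α i) (hq : ∀ i, β (q i) = α i) {Z : M} (f : α ⟶ₘ Z)
    (h : ∀ i, p i = q i) : act p hp f = act q hq f := by
  obtain rfl : p = q := funext h
  rfl

theorem act_eq_self {n : ℕ} {α : Fin n → M} {p : Fin n → Fin n}
    (hp : ∀ i, α (p i) = α i) {Z : M} (f : α ⟶ₘ Z) (h : ∀ i, p i = i) : act p hp f = f :=
  (act_congr hp (fun _ => rfl) f h).trans (act_id f)

theorem exists_act_of_arrow_eq {n m : ℕ} {α : Fin n → M} {β : Fin m → M} {Z : M}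
    {f : α ⟶ₘ Z} {g : β ⟶ₘ Z} (h : arrow f = arrow g) :
    ∃ (h : n = m) (hβ : ∀ i, β (Fin.cast h i) = α i), g = act (Fin.cast h) hβ f := by
  obtain rfl : n = m := congrArg (fun a => a.1.1) h
  simp only [arrow, Sigma.mk.injEq] at h
  obtain ⟨⟨-, h1⟩, h2⟩ := h
  cases eq_of_heq h1
  cases eq_of_heq h2
  exact ⟨rfl, fun _ => rfl, (act_id _).symm⟩

theorem arrow_act_cast {n m : ℕ} {α : Fin n → M} {β : Fin m → M} {p : Fin n → Fin m}
    (hp : ∀ i, β (p i) = α i) {Z : M} (f : α ⟶ₘ Z) (h : n = m) (h' : ∀ i, p i = Fin.cast h i) :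
    arrow (act p hp f) = arrow f := by
  subst h
  obtain rfl : p = fun i => i := funext h'
  obtain rfl : α = β := funext fun i => (hp i).symm
  rw [act_id]

theorem castDom_eq_act {n m : ℕ} {α : Fin n → M} {β : Fin m → M} (h : n = m)
    (hβ : ∀ i, β (Fin.cast h i) = α i) {Z : M} (f : α ⟶ₘ Z) :
    castDom h hβ f = act (Fin.cast h) hβ f :=
  arrow_inj ((arrow_castDom h hβ f).trans (arrow_act_cast hβ f h fun _ => rfl).symm)

/-- The composite of `f` with arrows `g i` having the same domain, followed by contraction. -/
def sub {n a : ℕ} {α : Fin a → M} {Y : Fin n → M} {Z : M} (f : Y ⟶ₘ Z) (g : ∀ i, α ⟶ₘ Y i) :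
    α ⟶ₘ Z := act (fun s : Fin (∑ _ : Fin n, a) => pos s) (fun _ => rfl) (comp f g)

theorem pos_join_const {n a : ℕ} (i : Fin n) (j : Fin a) :
    pos (k := fun _ : Fin n => a) (join (k := fun _ : Fin n => a) i j) = j :=
  dep_join_eq (k := fun _ : Fin n => a) (fun _ j => j) i j

theorem act_sub {n a b : ℕ} {α : Fin a → M} {β : Fin b → M} {Y : Fin n → M} {Z : M}
    (f : Y ⟶ₘ Z) (g : ∀ i, α ⟶ₘ Y i) (q : Fin a → Fin b) (hq : ∀ i, β (q i) = α i) :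
    act q hq (sub f g) = sub f (fun i => act q hq (g i)) := by
  rw [sub, sub, act_act, comp_act f (fun _ => q) (fun _ => hq) g, act_act]
  refine act_congr _ _ _ fun s => ?_
  rw [sumMap, pos_join_const]

theorem sub_act {n m a : ℕ} {α : Fin a → M} {Y : Fin m → M} {Z : M}
    (p : Fin n → Fin m) (f : (fun i => Y (p i)) ⟶ₘ Z) (g : ∀ i, α ⟶ₘ Y i) :
    sub (act p (fun _ => rfl) f) g = sub f (fun i => g (p i)) := by
  rw [sub, sub, act_comp, act_act]
  refine act_congr _ _ _ fun s => ?_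
  rw [blockMap, pos_join_const]

theorem comp_eq_sub {n : ℕ} {Y : Fin n → M} {Z : M} {k : Fin n → ℕ} {X : ∀ i, Fin (k i) → M}
    (f : Y ⟶ₘ Z) (g : ∀ i, X i ⟶ₘ Y i) :
    comp f g = sub f (fun i => act (join i) (concat_join X i) (g i)) := by
  rw [sub, comp_act f (fun i => join i) (fun i => concat_join X i) g, act_act]
  refine (act_eq_self _ _ fun s => ?_).symm
  rw [sumMap, pos_join_const, join_blk_pos]

theorem sub_comp {n a : ℕ} {α : Fin a → M} {Y : Fin n → M} {Z : M} {k : Fin n → ℕ}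
    {X : ∀ i, Fin (k i) → M} (f : Y ⟶ₘ Z) (g : ∀ i, X i ⟶ₘ Y i) (h : ∀ i j, α ⟶ₘ X i j) :
    sub (comp f g) (fun s => h (blk s) (pos s)) = sub f (fun i => sub (g i) (h i)) := by
  obtain ⟨h1, h2, h3⟩ := exists_act_of_arrow_eq (Multicategory.assoc f g h)
  have := comp_act f (fun i => fun s : Fin (∑ _ : Fin (k i), a) => pos s)
    (W := fun _ => α) (fun _ _ => rfl) (fun i => comp (g i) (h i))
  change _ = act _ _ (comp f (fun i => act (fun s : Fin (∑ _ : Fin (k i), a) => pos s)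
    (fun _ => rfl) (comp (g i) (h i))))
  rw [this, h3, act_act, act_act]
  refine act_congr _ _ _ fun t => ?_
  rw [sumMap, pos_join_const]
  exact congrArg (fun z : (i : Fin n) × (j : Fin (k i)) × Fin a => z.2.2)
    (sigma_assoc (fun _ _ => a) t _ rfl)

theorem sub_sub {n m a : ℕ} {α : Fin a → M} {Y : Fin n → M} {X : Fin m → M} {Z : M}
    (f : Y ⟶ₘ Z) (g : ∀ i, X ⟶ₘ Y i) (h : ∀ j, α ⟶ₘ X j) :
    sub (sub f g) h = sub f (fun i => sub (g i) h) := by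
  rw [← sub_comp f g (fun _ => h)]
  exact sub_act (Y := X) (fun s : Fin (∑ _ : Fin n, m) => pos s) (comp f g) h

theorem sub_act' {n m a : ℕ} {γ : Fin a → M} {α : Fin n → M} {β : Fin m → M} {Z : M}
    (p : Fin n → Fin m) (hp : ∀ i, β (p i) = α i) (f : α ⟶ₘ Z) (g : ∀ i, γ ⟶ₘ β i)
    (g' : ∀ i, γ ⟶ₘ α i) (h : ∀ i, g' i ≍ g (p i)) : sub (act p hp f) g = sub f g' := by
  obtain rfl : α = fun i => β (p i) := funext fun i => (hp i).symm
  obtain rfl : g' = fun i => g (p i) := funext fun i => eq_of_heq (h i)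
  exact sub_act p f g

theorem id_sub {a : ℕ} {α : Fin a → M} {Z : M} (g : α ⟶ₘ Z) :
    sub (MulticategoryStruct.id Z) (fun _ => g) = g := by
  obtain ⟨h1, h2, h3⟩ := exists_act_of_arrow_eq (Multicategory.id_comp g)
  conv_rhs => rw [h3]
  refine act_congr _ _ _ fun s => ?_
  induction s using join_cases with | _ i j
  rw [pos_join_const, join_one_left]

/-- The `i`-th projection. -/
def proj {n : ℕ} (α : Fin n → M) (i : Fin n) : α ⟶ₘ α i :=
  act (fun _ : Fin 1 => i) (fun _ => rfl) (MulticategoryStruct.id (α i))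

theorem proj_sub {n a : ℕ} {β : Fin a → M} {α : Fin n → M} (i : Fin n) (g : ∀ i, β ⟶ₘ α i) :
    sub (proj α i) g = g i :=
  (sub_act (Y := α) (fun _ : Fin 1 => i) (MulticategoryStruct.id (α i)) g).trans (id_sub _)

theorem sub_proj {n : ℕ} {α : Fin n → M} {Z : M} (f : α ⟶ₘ Z) : sub f (proj α) = f := by
  obtain ⟨h1, h2, h3⟩ := exists_act_of_arrow_eq (Multicategory.comp_id f)
  have := comp_act f (fun i => fun _ : Fin 1 => i) (W := fun _ => α) (fun _ _ => rfl)
    (fun i => MulticategoryStruct.id (α i))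
  refine (congrArg (act _ _) this).trans ?_
  rw [act_act]
  conv_rhs => rw [h3]
  refine act_congr _ _ _ fun s => ?_
  induction s using join_cases with | _ i j
  rw [sumMap_join, pos_join_const, join_one_right]

theorem act_eq_sub {n m : ℕ} {α : Fin n → M} {β : Fin m → M} {Z : M} (p : Fin n → Fin m)
    (f : (fun i => β (p i)) ⟶ₘ Z) :
    act p (fun _ => rfl) f = sub f (fun i => proj β (p i)) := by
  rw [← sub_act p f, sub_proj]

theorem arrow_comp_unary {n : ℕ} {X : Fin n → M} {A B : M} (u : (fun _ : Fin 1 => A) ⟶ₘ B)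
    (f : X ⟶ₘ A) : arrow (comp u (fun _ => f)) = arrow (sub u (fun _ => f)) := by
  refine (arrow_act_cast _ _ (by simp) fun s => ?_).symm
  induction s using join_cases with | _ i j
  rw [pos_join_const, join_one_left]

theorem arrow_comp_unaries {n : ℕ} {X Y : Fin n → M} {B : M} (g : Y ⟶ₘ B)
    (v : ∀ i, (fun _ : Fin 1 => X i) ⟶ₘ Y i) :
    arrow (comp g v) = arrow (sub g (fun i => act (β := X) (fun _ => i) (fun _ => rfl) (v i))) := by
  have := comp_act g (fun i => fun _ : Fin 1 => i) (W := fun _ => X) (fun _ _ => rfl) v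
  rw [sub, this, act_act]
  refine (arrow_act_cast _ _ (by simp) fun s => ?_).symm
  induction s using join_cases with | _ i j
  rw [sumMap_join, pos_join_const, join_one_right]

theorem square_iff {n : ℕ} {X Y : Fin n → M} {A B : M} (u : (fun _ : Fin 1 => A) ⟶ₘ B)
    (f : X ⟶ₘ A) (g : Y ⟶ₘ B) (v : ∀ i, (fun _ : Fin 1 => X i) ⟶ₘ Y i) :
    arrow (comp u (fun _ => f)) = arrow (comp g v) ↔
      sub u (fun _ => f) = sub g (fun i => act (β := X) (fun _ => i) (fun _ => rfl) (v i)) := by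
  rw [arrow_comp_unary, arrow_comp_unaries]
  exact ⟨arrow_inj, fun h => by rw [h]⟩

/-- Composition of unary arrows. -/
def unaryComp {A B C : M} (f : (fun _ : Fin 1 => A) ⟶ₘ B) (g : (fun _ : Fin 1 => B) ⟶ₘ C) :
    (fun _ : Fin 1 => A) ⟶ₘ C :=
  castDom (by simp) (fun _ => rfl) (comp g (fun _ => f))

theorem unaryComp_eq_sub {A B C : M} (f : (fun _ : Fin 1 => A) ⟶ₘ B)
    (g : (fun _ : Fin 1 => B) ⟶ₘ C) : unaryComp f g = sub g (fun _ => f) := by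
  rw [unaryComp, castDom_eq_act]
  exact act_congr _ _ _ fun s => Subsingleton.elim _ _

theorem sub_unary_id {A B : M} (f : (fun _ : Fin 1 => A) ⟶ₘ B) :
    sub f (fun _ => MulticategoryStruct.id A) = f := by
  conv_rhs => rw [← sub_proj f]
  congr 1
  funext i
  exact (act_eq_self _ _ fun _ => Subsingleton.elim _ _).symm

end Substitution

namespace FpFunctor

variable {M : Type u} {N : Type u'} [CartesianMulticategory.{v} M] [CartesianMulticategory.{v'} N]
  (F : FpFunctor M N)

theorem arrow_map {n m : ℕ} {X : Fin n → M} {Y : Fin m → M} {Z : M} {f : X ⟶ₘ Z} {g : Y ⟶ₘ Z}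
    (h : arrow f = arrow g) : arrow (F.map f) = arrow (F.map g) := by
  obtain ⟨h1, h2, rfl⟩ := exists_act_of_arrow_eq h
  rw [F.map_act, arrow_act_cast _ _ h1 fun _ => rfl]

theorem map_sub {n a : ℕ} {α : Fin a → M} {Y : Fin n → M} {Z : M} (f : Y ⟶ₘ Z)
    (g : ∀ i, α ⟶ₘ Y i) : F.map (sub f g) = sub (F.map f) (fun i => F.map (g i)) := by
  refine (F.map_act _ _ _).trans ?_
  rw [F.map_comp f g]
  rfl

theorem map_unaryComp {A B C : M} (f : (fun _ : Fin 1 => A) ⟶ₘ B)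
    (g : (fun _ : Fin 1 => B) ⟶ₘ C) :
    F.map (unaryComp f g) = unaryComp (F.map f) (F.map g) := by
  rw [unaryComp_eq_sub, map_sub]
  exact (unaryComp_eq_sub (F.map f) (F.map g)).symm

end FpFunctor

/-! ### Commutative monoids in a cartesian multicategory -/

section CMon

/-- Two arrows with codomain `X` whose domains are constant sequences at `X`. -/
def pairHom {M : Type u} [MulticategoryStruct.{v} M] {X : M} {a b : ℕ}
    (f : (fun _ : Fin a => X) ⟶ₘ X) (g : (fun _ : Fin b => X) ⟶ₘ X) :
    ∀ i : Fin 2, (fun _ : Fin (![a, b] i) => X) ⟶ₘ X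
  | 0 => f
  | 1 => g

/-- Commutative monoids in a cartesian multicategory. -/
structure CMonObj (M : Type u) [CartesianMulticategory.{v} M] where
  X : M
  /-- the binary operation `m₂` -/
  mul : (fun _ : Fin 2 => X) ⟶ₘ X
  /-- the nullary operation `m₀` -/
  one : (fun _ : Fin 0 => X) ⟶ₘ X
  mul_assoc : arrow (comp mul (pairHom mul (MulticategoryStruct.id X)))
    = arrow (comp mul (pairHom (MulticategoryStruct.id X) mul))
  one_mul : arrow (comp mul (pairHom one (MulticategoryStruct.id X)))
    = arrow (MulticategoryStruct.id X)
  mul_one : arrow (comp mul (pairHom (MulticategoryStruct.id X) one))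
    = arrow (MulticategoryStruct.id X)
  mul_comm : act (Equiv.swap (0 : Fin 2) 1) (fun _ => rfl) mul = mul

/-- Morphisms of commutative monoids in a cartesian multicategory. -/
@[ext]
structure CMonHom {M : Type u} [CartesianMulticategory.{v} M] (A B : CMonObj M) where
  hom : (fun _ : Fin 1 => A.X) ⟶ₘ B.X
  map_mul : arrow (comp hom (fun _ => A.mul)) = arrow (comp B.mul (fun _ => hom))
  map_one : arrow (comp hom (fun _ => A.one)) = arrow B.one

variable {M : Type u} [CartesianMulticategory.{v} M]

namespace CMonObj

variable (A : CMonObj M) {a : ℕ} {α : Fin a → M}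

/-- The sum of two arrows into a commutative monoid. -/
def add (x y : α ⟶ₘ A.X) : α ⟶ₘ A.X := sub A.mul ![x, y]

/-- The zero arrow into a commutative monoid. -/
def zero (α : Fin a → M) : α ⟶ₘ A.X := sub A.one (fun i => i.elim0)

theorem sub_eq_of_arrow_eq {n m : ℕ} {X : Fin n → M} {Y : Fin m → M} {Z : M} {f : X ⟶ₘ Z}
    {g : Y ⟶ₘ Z} (h : arrow f = arrow g) (x : ∀ i, α ⟶ₘ X i) (y : ∀ i, α ⟶ₘ Y i)
    (hxy : ∀ (i : Fin n) (j : Fin m), (i : ℕ) = (j : ℕ) → x i ≍ y j) : sub f x = sub g y := by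
  obtain rfl : n = m := congrArg (fun a => a.1.1) h
  simp only [arrow, Sigma.mk.injEq] at h
  obtain ⟨⟨-, h1⟩, h2⟩ := h
  cases eq_of_heq h1
  cases eq_of_heq h2
  congr 1
  funext i
  exact eq_of_heq (hxy i i rfl)

theorem eq_of_join {k : Fin 2 → ℕ} {A : Type w} (x : ∀ i, Fin (k i) → A) (w : ℕ → A)
    (h0 : ∀ j, x 0 j = w j) (h1 : ∀ j, x 1 j = w (k 0 + j)) (s : Fin (∑ i, k i)) :
    x (blk s) (pos s) = w s := by
  induction s using join_cases with | _ i j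
  rw [dep_join_eq x i j, join_val]
  fin_cases i
  · simpa using h0 j
  · have : (Finset.univ.filter fun a : Fin 2 => a < 1) = {0} := by decide
    simp only [Fin.mk_one]
    rw [this]
    simpa using h1 j

theorem sub_mul (z : Fin 2 → (α ⟶ₘ A.X)) : sub A.mul z = A.add (z 0) (z 1) := by
  rw [add]
  congr 1
  funext i
  fin_cases i <;> rfl

theorem sub_one (z : Fin 0 → (α ⟶ₘ A.X)) : sub A.one z = A.zero α := by
  rw [zero]
  congr 1
  funext i
  exact i.elim0

theorem zero_eq_act (α : Fin a → M) :
    A.zero α = act (fun i : Fin 0 => i.elim0) (fun i => i.elim0) A.one := by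
  rw [← sub_proj (act _ _ A.one), sub_act' _ _ A.one _ (fun i => i.elim0) (fun i => i.elim0)]
  rfl

theorem sub_add {b : ℕ} {β : Fin b → M} (x y : α ⟶ₘ A.X) (h : ∀ i, β ⟶ₘ α i) :
    sub (A.add x y) h = A.add (sub x h) (sub y h) := by
  rw [add, sub_sub, sub_mul]; rfl

theorem sub_zero {b : ℕ} {β : Fin b → M} (h : ∀ i, β ⟶ₘ α i) :
    sub (A.zero α) h = A.zero β := by
  rw [zero, sub_sub, sub_one]

theorem sub_comp_pair {b c : ℕ} (f : (fun _ : Fin b => A.X) ⟶ₘ A.X)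
    (g : (fun _ : Fin c => A.X) ⟶ₘ A.X) (x : ∀ i, Fin (![b, c] i) → (α ⟶ₘ A.X)) :
    sub (comp A.mul (pairHom f g)) (fun s => x (blk s) (pos s))
      = A.add (sub f (x 0)) (sub g (x 1)) := by
  rw [sub_comp A.mul (pairHom f g) x, sub_mul]
  rfl

theorem add_assoc' (x y z : α ⟶ₘ A.X) : A.add (A.add x y) z = A.add x (A.add y z) := by
  have h1 := A.sub_comp_pair A.mul (MulticategoryStruct.id A.X)
    (fun i => match i with
      | 0 => ![x, y]
      | 1 => fun _ => z)
  have h2 := A.sub_comp_pair (MulticategoryStruct.id A.X) A.mul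
    (fun i => match i with
      | 0 => fun _ => x
      | 1 => ![y, z])
  have h3 : A.add (A.add x y) z = A.add (A.add x y) (sub (MulticategoryStruct.id A.X) fun _ => z) := by
    rw [id_sub]
  have h4 : A.add x (A.add y z) = A.add (sub (MulticategoryStruct.id A.X) fun _ => x) (A.add y z) := by
    rw [id_sub]
  refine h3.trans (h1.symm.trans (Eq.trans ?_ (h2.trans h4.symm)))
  refine sub_eq_of_arrow_eq A.mul_assoc _ _ ?_
  intro s t hst
  refine heq_of_eq ?_
  have e1 := eq_of_join (k := ![2, 1]) (A := α ⟶ₘ A.X) (fun i => match i with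
      | 0 => ![x, y]
      | 1 => fun _ => z) (fun c => if c = 0 then x else if c = 1 then y else z)
      (by intro (j : Fin 2); fin_cases j <;> simp) (by intro (j : Fin 1); fin_cases j; simp) s
  have e2 := eq_of_join (k := ![1, 2]) (A := α ⟶ₘ A.X) (fun i => match i with
      | 0 => fun _ => x
      | 1 => ![y, z]) (fun c => if c = 0 then x else if c = 1 then y else z)
      (by intro (j : Fin 1); fin_cases j; simp) (by intro (j : Fin 2); fin_cases j <;> simp) t
  refine e1.trans (Eq.trans ?_ e2.symm)
  simp only [hst]

theorem zero_add' (x : α ⟶ₘ A.X) : A.add (A.zero α) x = x := by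
  have h1 := A.sub_comp_pair A.one (MulticategoryStruct.id A.X)
    (fun i => match i with
      | 0 => fun j : Fin 0 => j.elim0
      | 1 => fun _ => x)
  have h3 : A.add (A.zero α) x = A.add (A.zero α) (sub (MulticategoryStruct.id A.X) fun _ => x) := by
    rw [id_sub]
  refine h3.trans (h1.symm.trans (Eq.trans ?_ (id_sub x)))
  refine sub_eq_of_arrow_eq A.one_mul _ _ ?_
  intro s t hst
  refine heq_of_eq ?_
  exact eq_of_join (k := ![0, 1]) (A := α ⟶ₘ A.X) (fun i => match i with
      | 0 => fun j : Fin 0 => j.elim0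
      | 1 => fun _ => x) (fun _ => x) (fun j : Fin 0 => j.elim0) (fun _ => rfl) s

theorem add_comm' (x y : α ⟶ₘ A.X) : A.add x y = A.add y x := by
  conv_lhs => rw [add, ← A.mul_comm]
  refine (sub_act (Y := fun _ : Fin 2 => A.X) (Equiv.swap (0 : Fin 2) 1) A.mul ![x, y]).trans ?_
  rw [sub_mul]
  simp

/-- Arrows from a given domain into a commutative monoid form a commutative monoid. -/
@[reducible] def homMonoid (α : Fin a → M) : AddCommMonoid (α ⟶ₘ A.X) :=
  letI : Add (α ⟶ₘ A.X) := ⟨A.add⟩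
  letI : Zero (α ⟶ₘ A.X) := ⟨A.zero α⟩
  { add_assoc := A.add_assoc'
    zero_add := A.zero_add'
    add_zero := fun x => (A.add_comm' x _).trans (A.zero_add' x)
    add_comm := A.add_comm'
    nsmul := nsmulRec }

theorem add_add_add_comm' (x y z w : α ⟶ₘ A.X) :
    A.add (A.add x y) (A.add z w) = A.add (A.add x z) (A.add y w) := by
  let := A.homMonoid α
  exact add_add_add_comm x y z w

end CMonObj

theorem act_const_eq_sub {n : ℕ} {X : Fin n → M} {B : M} (i : Fin n)
    (v : (fun _ : Fin 1 => X i) ⟶ₘ B) :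
    act (β := X) (fun _ => i) (fun _ => rfl) v = sub v (fun _ => proj X i) :=
  act_eq_sub (α := fun _ => X i) (fun _ : Fin 1 => i) v

namespace CMonHom

/-- The two conditions on a morphism of commutative monoids, in terms of substitution. -/
theorem map_add {A B : CMonObj M} (f : CMonHom A B) {a : ℕ} {α : Fin a → M} (x y : α ⟶ₘ A.X) :
    sub f.hom (fun _ => A.add x y)
      = B.add (sub f.hom (fun _ => x)) (sub f.hom (fun _ => y)) := by
  have h := (square_iff (X := fun _ : Fin 2 => A.X) (Y := fun _ : Fin 2 => B.X)
    f.hom A.mul B.mul (fun _ => f.hom)).1 f.map_mul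
  have h' := congrArg (fun z => sub z ![x, y]) h
  have e1 : ∀ i : Fin 2, sub (act (β := fun _ : Fin 2 => A.X) (fun _ : Fin 1 => i)
      (fun _ => rfl) f.hom) ![x, y] = sub f.hom (fun _ => ![x, y] i) := fun i =>
    sub_act (Y := fun _ : Fin 2 => A.X) (fun _ : Fin 1 => i) f.hom ![x, y]
  rw [B.sub_mul, B.sub_add, e1, e1, sub_sub] at h'
  exact h'

theorem map_zero {A B : CMonObj M} (f : CMonHom A B) {a : ℕ} (α : Fin a → M) :
    sub f.hom (fun _ => A.zero α) = B.zero α := by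
  rw [CMonObj.zero, ← sub_sub]
  exact CMonObj.sub_eq_of_arrow_eq ((arrow_comp_unary f.hom A.one).symm.trans f.map_one) _ _
    (fun i => i.elim0)

/-- Construction of a morphism of commutative monoids from conditions on substitution. -/
def mk' {A B : CMonObj M} (f : (fun _ : Fin 1 => A.X) ⟶ₘ B.X)
    (h : ∀ x y : (fun _ : Fin 2 => A.X) ⟶ₘ A.X,
      sub f (fun _ => A.add x y) = B.add (sub f (fun _ => x)) (sub f (fun _ => y)))
    (h0 : sub f (fun _ => A.zero (fun _ : Fin 0 => A.X)) = B.zero (fun _ : Fin 0 => A.X)) :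
    CMonHom A B where
  hom := f
  map_mul := by
    refine (square_iff (X := fun _ : Fin 2 => A.X) (Y := fun _ : Fin 2 => B.X)
      f A.mul B.mul (fun _ => f)).2 ?_
    have := h (proj (fun _ : Fin 2 => A.X) 0) (proj (fun _ : Fin 2 => A.X) 1)
    rw [← A.sub_mul (proj (fun _ : Fin 2 => A.X)), sub_proj] at this
    rw [this, B.sub_mul]
    congr 1
    · exact (act_const_eq_sub (X := fun _ : Fin 2 => A.X) 0 f).symm
    · exact (act_const_eq_sub (X := fun _ : Fin 2 => A.X) 1 f).symm
  map_one := by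
    rw [arrow_comp_unary]
    have e : A.zero (fun _ : Fin 0 => A.X) = A.one := by
      rw [← A.sub_one (proj (fun _ : Fin 0 => A.X)), sub_proj]
    have e' : B.zero (fun _ : Fin 0 => B.X) = B.one := by
      rw [← B.sub_one (proj (fun _ : Fin 0 => B.X)), sub_proj]
    rw [← e, h0, ← e']
    rw [show (fun _ : Fin 0 => A.X) = (fun _ : Fin 0 => B.X) from funext fun i => i.elim0]

end CMonHom

instance : Category (CMonObj M) where
  Hom A B := CMonHom A B
  id A := CMonHom.mk' (MulticategoryStruct.id A.X) (fun x y => by simp only [id_sub])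
    (by rw [id_sub])
  comp f g := CMonHom.mk' (unaryComp f.hom g.hom)
    (fun x y => by simp only [unaryComp_eq_sub, sub_sub, CMonHom.map_add])
    (by simp only [unaryComp_eq_sub, sub_sub, CMonHom.map_zero])
  id_comp f := CMonHom.ext ((unaryComp_eq_sub (MulticategoryStruct.id _) f.hom).trans
    (sub_unary_id _))
  comp_id f := CMonHom.ext ((unaryComp_eq_sub f.hom (MulticategoryStruct.id _)).trans
    (id_sub _))
  assoc f g h := CMonHom.ext (by
    change unaryComp (unaryComp f.hom g.hom) h.hom = unaryComp f.hom (unaryComp g.hom h.hom)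
    simp only [unaryComp_eq_sub, sub_sub])

namespace CMonHom

variable {A B : CMonObj M}

/-- `f + g` is `m₂ (f, g)` followed by contraction. -/
instance : Add (A ⟶ B) where
  add f g := mk' (act (fun s : Fin (∑ _ : Fin 2, 1) => pos s) (fun _ => rfl)
      (comp B.mul ![f.hom, g.hom]))
    (fun x y => by
      change sub (B.add f.hom g.hom) _ = B.add (sub (B.add f.hom g.hom) _)
        (sub (B.add f.hom g.hom) _)
      simp only [CMonObj.sub_add, map_add]
      exact B.add_add_add_comm' _ _ _ _)
    (by
      change sub (B.add f.hom g.hom) _ = _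
      simp only [CMonObj.sub_add, map_zero]
      exact B.zero_add' _)

/-- `0` is `m₀` followed by weakening. -/
instance : Zero (A ⟶ B) where
  zero := mk' (act (fun i : Fin 0 => i.elim0) (fun i => i.elim0) B.one)
    (fun x y => by
      rw [← CMonObj.zero_eq_act, CMonObj.sub_zero, CMonObj.sub_zero, CMonObj.sub_zero]
      exact (B.zero_add' _).symm)
    (by rw [← CMonObj.zero_eq_act, CMonObj.sub_zero])

theorem add_hom (f g : A ⟶ B) : (f + g).hom = B.add f.hom g.hom := rfl

theorem zero_hom : (0 : A ⟶ B).hom = B.zero (fun _ : Fin 1 => A.X) :=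
  (B.zero_eq_act _).symm

instance : AddCommMonoid (A ⟶ B) where
  add_assoc f g h := CMonHom.ext (B.add_assoc' _ _ _)
  zero_add f := CMonHom.ext (by rw [add_hom, zero_hom]; exact B.zero_add' _)
  add_zero f := CMonHom.ext (by
    rw [add_hom, zero_hom]; exact (B.add_comm' _ _).trans (B.zero_add' _))
  add_comm f g := CMonHom.ext (B.add_comm' _ _)
  nsmul := nsmulRec

end CMonHom

instance : CMonEnriched (CMonObj M) where
  homAddCommMonoid _ _ := inferInstance
  add_comp f g h := CMonHom.ext (by
    change unaryComp (f + g).hom h.hom = (f ≫ h + g ≫ h).hom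
    rw [unaryComp_eq_sub, CMonHom.add_hom, CMonHom.map_add, CMonHom.add_hom]
    congr 1 <;> exact (unaryComp_eq_sub _ _).symm)
  comp_add f g h := CMonHom.ext (by
    change unaryComp f.hom (g + h).hom = (f ≫ g + f ≫ h).hom
    rw [unaryComp_eq_sub, CMonHom.add_hom, CMonObj.sub_add, CMonHom.add_hom]
    congr 1 <;> exact (unaryComp_eq_sub _ _).symm)
  zero_comp {A B C} h := CMonHom.ext (by
    refine (unaryComp_eq_sub (0 : A ⟶ B).hom h.hom).trans ?_
    rw [CMonHom.zero_hom, CMonHom.map_zero, CMonHom.zero_hom])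
  comp_zero {A B C} f := CMonHom.ext (by
    refine (unaryComp_eq_sub f.hom (0 : B ⟶ C).hom).trans ?_
    rw [CMonHom.zero_hom, CMonObj.sub_zero, CMonHom.zero_hom])

end CMon

/-! ### The two functors -/

theorem AddFunctor.map_sumAlong {C : Type u} {D : Type u'} [Category.{v} C] [Category.{v'} D]
    [CMonEnriched C] [CMonEnriched D] (F : AddFunctor C D) {n m : ℕ} {X : Fin n → C}
    {Y : Fin m → C} (p : Fin n → Fin m) (hp : ∀ i, Y (p i) = X i) {Z : C} (f : ∀ i, X i ⟶ Z)
    (j : Fin m) : F.map (sumAlong p hp f j)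
      = sumAlong (Y := fun j => F.obj (Y j)) p (fun i => congrArg F.obj (hp i))
          (fun i => F.map (f i)) j := by
  let φ : (Y j ⟶ Z) →+ (F.obj (Y j) ⟶ F.obj Z) :=
    { toFun := fun h => F.map h
      map_zero' := F.map_zero _ _
      map_add' := F.map_add }
  refine (_root_.map_sum φ _ _).trans (Finset.sum_congr rfl fun i _ => ?_)
  by_cases h : p i = j
  · rw [dif_pos h, dif_pos h]
    refine (F.map_comp _ _).trans ?_
    rw [eqToHom_map]
  · rw [dif_neg h, dif_neg h]
    exact F.map_zero _ _

/-- The discrete cocone functor on morphisms: `F ⟨f₁, …, fₙ⟩ = ⟨F f₁, …, F fₙ⟩`. -/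
def coconeMap {C : Type u} {D : Type u'} [Category.{v} C] [Category.{v'} D] [CMonEnriched C]
    [CMonEnriched D] (F : AddFunctor C D) : FpFunctor (DiscreteCocone C) (DiscreteCocone D) where
  obj := F.obj
  map f i := F.map (f i)
  map_id X := funext fun _ => F.map_id X
  map_comp f g := funext fun s => F.map_comp (g (blk s) (pos s)) (f (blk s))
  map_act p hp _ f := funext fun j => F.map_sumAlong p hp f j

/-- The functor `(-)_▶` from preadditive categories to cartesian multicategories. -/
def coconeFunctor : CMonCat.{v, u} ⥤ FpMlt.{v, u} where
  obj C := ⟨DiscreteCocone C.carrier⟩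
  map {C D} F := coconeMap (C := C.carrier) (D := D.carrier) F
  map_id _ := rfl
  map_comp _ _ := rfl

section

variable {M : Type u} {N : Type u'} [CartesianMulticategory.{v} M] [CartesianMulticategory.{v'} N]

theorem FpFunctor.map_comp_pairHom (F : FpFunctor M N) {X : M} {a b : ℕ}
    (m : (fun _ : Fin 2 => X) ⟶ₘ X) (f : (fun _ : Fin a => X) ⟶ₘ X)
    (g : (fun _ : Fin b => X) ⟶ₘ X) :
    F.map (MulticategoryStruct.comp m (pairHom f g))
      = MulticategoryStruct.comp (F.map m) (pairHom (F.map f) (F.map g)) := by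
  refine (F.map_comp _ _).trans ?_
  congr 1
  funext i
  match i with
  | 0 => rfl
  | 1 => rfl

/-- The image of a commutative monoid under an fp-functor. -/
def FpFunctor.mapCMonObj (F : FpFunctor M N) (A : CMonObj M) : CMonObj N where
  X := F.obj A.X
  mul := F.map A.mul
  one := F.map A.one
  mul_assoc := by
    have h := F.arrow_map A.mul_assoc
    have h1 := F.map_comp_pairHom A.mul A.mul (MulticategoryStruct.id A.X)
    have h2 := F.map_comp_pairHom A.mul (MulticategoryStruct.id A.X) A.mul
    rw [F.map_id] at h1 h2
    exact (congrArg arrow h1).symm.trans (h.trans (congrArg arrow h2))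
  one_mul := by
    have h := F.arrow_map A.one_mul
    have h1 := F.map_comp_pairHom A.mul A.one (MulticategoryStruct.id A.X)
    rw [F.map_id] at h h1
    exact (congrArg arrow h1).symm.trans h
  mul_one := by
    have h := F.arrow_map A.mul_one
    have h1 := F.map_comp_pairHom A.mul (MulticategoryStruct.id A.X) A.one
    rw [F.map_id] at h h1
    exact (congrArg arrow h1).symm.trans h
  mul_comm := (F.map_act _ _ _).symm.trans (congrArg F.map A.mul_comm)

/-- The image of a morphism of commutative monoids under an fp-functor. -/
def FpFunctor.mapCMonHom (F : FpFunctor M N) {A B : CMonObj M} (f : A ⟶ B) :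
    F.mapCMonObj A ⟶ F.mapCMonObj B where
  hom := F.map f.hom
  map_mul := by
    have := F.arrow_map f.map_mul
    rwa [F.map_comp, F.map_comp] at this
  map_one := by
    have := F.arrow_map f.map_one
    rwa [F.map_comp] at this

/-- The additive functor between categories of commutative monoids induced by an fp-functor. -/
def FpFunctor.mapCMon (F : FpFunctor M N) : AddFunctor (CMonObj M) (CMonObj N) where
  obj := F.mapCMonObj
  map := F.mapCMonHom
  map_id A := CMonHom.ext (F.map_id A.X)
  map_comp f g := CMonHom.ext (F.map_unaryComp f.hom g.hom)
  map_add {A B} f g := CMonHom.ext (by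
    refine (F.map_sub B.mul ![f.hom, g.hom]).trans ?_
    exact CMonObj.sub_mul (F.mapCMonObj B) _)
  map_zero A B := CMonHom.ext (F.map_act _ _ _)

end

/-- The functor `cMon(-)` from cartesian multicategories to preadditive categories. -/
def cMonFunctor : FpMlt.{v, max u v} ⥤ CMonCat.{v, max u v} where
  obj M := ⟨CMonObj M.carrier⟩
  map F := FpFunctor.mapCMon F
  map_id _ := rfl
  map_comp _ _ := rfl

/-! ### Modules over a rig -/

/-- Functors of cartesian multicategories and natural transformations form a category. -/
instance {M : Type u} {N : Type u'} [CartesianMulticategory.{v} M] [CartesianMulticategory.{v'} N] :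
    Category (FpFunctor M N) where
  Hom F G := MultiNatTrans F.toMultiFunctor G.toMultiFunctor
  id F :=
    { app := fun X => MulticategoryStruct.id (F.obj X)
      naturality := fun f =>
        (Multicategory.id_comp (F.map f)).trans (Multicategory.comp_id (F.map f)).symm }
  comp {F G H} σ τ :=
    { app := fun X => unaryComp (σ.app X) (τ.app X)
      naturality := fun {n X Z} f => by
        have h1 := (square_iff _ _ _ _).1 (σ.naturality f)
        have h2 := (square_iff _ _ _ _).1 (τ.naturality f)
        refine (square_iff _ _ _ _).2 ?_
        rw [unaryComp_eq_sub, sub_sub, h1, ← sub_sub, h2, sub_sub]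
        refine congrArg _ (funext fun i => ?_)
        rw [unaryComp_eq_sub, act_sub]
        exact sub_act (Y := fun i => G.obj (X i)) (fun _ : Fin 1 => i) (τ.app (X i)) _ }
  id_comp σ := MultiNatTrans.ext (funext fun X =>
    (unaryComp_eq_sub (MulticategoryStruct.id _) (σ.app X)).trans (sub_unary_id _))
  comp_id σ := MultiNatTrans.ext (funext fun X =>
    (unaryComp_eq_sub (σ.app X) (MulticategoryStruct.id _)).trans (id_sub _))
  assoc {F G H K} σ τ υ := MultiNatTrans.ext (funext fun X => by
    change unaryComp (unaryComp (σ.app X) (τ.app X)) (υ.app X)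
      = unaryComp (σ.app X) (unaryComp (τ.app X) (υ.app X))
    simp only [unaryComp_eq_sub, sub_sub])

section

variable (R : Type r) [Semiring R]

/-- The fp-functor of a module: `⟨λ₁, …, λₙ⟩` acts by `(x₁, …, xₙ) ↦ λ₁ x₁ + ⋯ + λₙ xₙ`. -/
def linearCombinations (E : Type w) [AddCommMonoid E] [Module R E] :
    FpFunctor (DiscreteCocone (SingleObj R)) (Type w) where
  obj _ := E
  map {n _ _} f := fun x => ∑ i : Fin n, (show R from f i) • (show E from x i)
  map_id _ := by
    funext x
    refine (Fin.sum_univ_one _).trans ?_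
    exact one_smul R (show E from x 0)
  map_comp {n Y Z k X} f g := by
    funext x
    refine (sum_join _).trans (Finset.sum_congr rfl fun i _ => ?_)
    refine Eq.trans ?_ Finset.smul_sum.symm
    refine Finset.sum_congr rfl fun j _ => ?_
    refine Eq.trans ?_ (mul_smul (show R from f i) (show R from g i j) _)
    refine congrArg (fun c : R => c • (show E from x (join i j))) ?_
    exact dep_join_eq (P := R) (fun i j => (show R from f i) * (show R from g i j)) i j
  map_act {n m α β} p hp _ f := by
    funext x
    change ∑ j, (show R from sumAlong (C := SingleObj R) p hp f j) • (show E from x j)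
      = ∑ i, (show R from f i) • (show E from x (p i))
    have h1 : ∀ j, (show R from sumAlong (C := SingleObj R) p hp f j) • (show E from x j)
        = ∑ i, if p i = j then (show R from f i) • (show E from x j) else 0 := by
      intro j
      refine (Finset.sum_smul (R := R)).trans (Finset.sum_congr rfl fun i _ => ?_)
      by_cases h : p i = j
      · rw [dif_pos h, if_pos h]
        refine congrArg (fun c : R => c • (show E from x j)) ?_
        have key : ∀ (A B : SingleObj R) (h : A = B), (show R from eqToHom h) = 1 := by
          rintro A B rfl; rfl
        refine (congrArg (fun c : R => (show R from f i) * c) (key _ _ _)).trans (mul_one (show R from f i))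
      · rw [dif_neg h, if_neg h]
        exact zero_smul R (show E from x j)
    rw [Finset.sum_congr rfl fun j _ => h1 j, Finset.sum_comm]
    refine Finset.sum_congr rfl fun i _ => ?_
    simp

/-- Modules over a rig `R` as fp-functors `R_▶ ⟶ Set_×`. -/
def moduleFunctor :
    SemimoduleCat.{w} R ⥤ FpFunctor (DiscreteCocone (SingleObj R)) (Type w) where
  obj E := linearCombinations R E
  map {E E'} φ :=
    { app := fun _ x => φ.hom (x 0)
      naturality := fun {n X Z} f => by
        refine set_arrow_ext _ _ (by simp) (fun _ => rfl) ?_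
        intro x y hxy
        change φ.hom (∑ i : Fin n, (show R from f i) • (show E from _))
          = ∑ i : Fin n, (show R from f i) • (show E' from _)
        refine (_root_.map_sum φ.hom _ _).trans (Finset.sum_congr rfl fun i _ => ?_)
        refine (φ.hom.map_smul _ _).trans ?_
        refine congrArg (fun e : E' => (show R from f i) • e) (congrArg φ.hom ?_)
        refine (eq_of_heq (hxy (join 0 i))).symm.trans (congrArg y ?_)
        apply Fin.ext
        exact (congrArg Fin.val (join_one_left (0 : Fin 1) i (by simp))).trans
          (congrArg Fin.val (join_one_right i (0 : Fin 1) (by simp))).symm }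
  map_id E := rfl
  map_comp φ ψ := rfl

end
end CartMult

/-!
The adjunction is given by its unit and counit.

In `C_▶` every object of `C` is a commutative monoid, with operation `⟨1, 1⟩` and neutral element
`⟨⟩`, and every arrow of `C` is a morphism of these monoids; this is the unit
`canonicalMonoidFunctor`. In the other direction the arrows `X₁, …, Xₙ ⟶ Z` of a cartesian
multicategory form a commutative monoid as soon as `Z` is one, so that morphisms `fᵢ : Xᵢ ⟶ Z` of
commutative monoids have a sum `f₁ x₁ + ⋯ + fₙ xₙ`, called `CMonObj.cotuple`; this is the counit
`cotupleFunctor`. It preserves composition and the actions because reindexing, substitution in the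
first argument and post-composition with a morphism of commutative monoids are all additive.

The first triangle identity is `cotuple_canonicalMonoidMap`: addition in the canonical monoids of
`C_▶` is computed entrywise, so an arrow `⟨f₁, …, fₙ⟩` is the sum of its entries. The second one
says that the sum of the two projections `A, A ⟶ A` is the multiplication of the monoid `A`, and
that the empty sum is its neutral element (`mapCMonObj_canonicalMonoid`).

For modules over a rig `R`, commutative monoids in `Set_×` are commutative monoids in the usual
sense, and an fp-functor `F : R_▶ ⟶ Set_×` makes the image of the canonical monoid of `R_▶` into an
`R`-module. Since an arrow of `R_▶` is the sum of its entries, `F` sends it to the corresponding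
linear combination (`FpFunctor.map_eq_cotuple`), so `F` is the fp-functor of that module. A module
structure is determined by its linear combinations, since `⟨1, 1⟩` gives the addition and `⟨c⟩` the
multiplication by `c`; naturality at these two kinds of arrows is linearity.
-/

namespace CartMult

open MulticategoryStruct CartesianMulticategory

/-! ### Equality of functors and of morphisms of monoids -/

theorem FpFunctor.hext {M : Type u} {N : Type u'} [CartesianMulticategory.{v} M]
    [CartesianMulticategory.{v'} N] {F G : FpFunctor M N} (h : F.obj = G.obj)
    (hmap : ∀ {n : ℕ} {X : Fin n → M} {Z : M} (f : X ⟶ₘ Z), F.map f ≍ G.map f) : F = G := by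
  obtain ⟨⟨obj, map, _, _⟩, _⟩ := F
  obtain ⟨⟨obj', map', _, _⟩, _⟩ := G
  dsimp only at h
  subst h
  obtain rfl : @map = @map' := by
    funext n X Z f
    exact eq_of_heq (hmap f)
  rfl

theorem AddFunctor.toFunctor_injective {C : Type u} {D : Type u'} [Category.{v} C]
    [Category.{v'} D] [CMonEnriched C] [CMonEnriched D] :
    Function.Injective (AddFunctor.toFunctor : AddFunctor C D → C ⥤ D) := by
  rintro ⟨F, _, _⟩ ⟨G, _, _⟩ h
  cases h
  rfl

theorem CMonObj.ext_heq {M : Type u} [CartesianMulticategory.{v} M] {A B : CMonObj M}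
    (hX : A.X = B.X) (hmul : A.mul ≍ B.mul) (hone : A.one ≍ B.one) : A = B := by
  cases A
  cases B
  dsimp only at hX
  subst hX
  cases hmul
  cases hone
  rfl

theorem CMonHom.hext {M : Type u} [CartesianMulticategory.{v} M] {A A' B B' : CMonObj M}
    (hA : A = A') (hB : B = B') {f : A ⟶ B} {g : A' ⟶ B'} (h : f.hom ≍ g.hom) : f ≍ g := by
  subst hA hB
  exact heq_of_eq (CMonHom.ext (eq_of_heq h))

/-- Additive functors into commutative monoids agree if their values have the same underlying
objects, operations and arrows. -/
theorem AddFunctor.cMon_hext {C : Type u} [Category.{v} C] [CMonEnriched C] {M : Type u'}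
    [CartesianMulticategory.{v'} M] {F G : AddFunctor C (CMonObj M)}
    (hobj : ∀ X, F.obj X = G.obj X)
    (hmap : ∀ {X Y : C} (f : X ⟶ Y), (F.map f).hom ≍ (G.map f).hom) : F = G :=
  toFunctor_injective
    (Functor.hext hobj fun X Y f => CMonHom.hext (hobj X) (hobj Y) (hmap f))

/-! ### Sums of arrows into a commutative monoid -/

section Sums

variable {M : Type u} [CartesianMulticategory.{v} M]

namespace CMonObj

variable (A : CMonObj M)

theorem act_add {a b : ℕ} {α : Fin a → M} {β : Fin b → M} (q : Fin a → Fin b)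
    (hq : ∀ i, β (q i) = α i) (x y : α ⟶ₘ A.X) :
    act q hq (A.add x y) = A.add (act q hq x) (act q hq y) := by
  rw [add, act_sub, sub_mul]
  rfl

theorem act_zero {a b : ℕ} {α : Fin a → M} {β : Fin b → M} (q : Fin a → Fin b)
    (hq : ∀ i, β (q i) = α i) : act q hq (A.zero α) = A.zero β := by
  rw [zero, act_sub, sub_one]

attribute [local instance] homMonoid

/-- Reindexing is additive on arrows into a commutative monoid. -/
def actHom {a b : ℕ} {α : Fin a → M} {β : Fin b → M} (q : Fin a → Fin b)
    (hq : ∀ i, β (q i) = α i) : (α ⟶ₘ A.X) →+ (β ⟶ₘ A.X) where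
  toFun := act q hq
  map_zero' := A.act_zero q hq
  map_add' := A.act_add q hq

/-- Substitution into an arrow with values in a commutative monoid is additive in that arrow. -/
def subHom {a b : ℕ} {α : Fin a → M} {β : Fin b → M} (h : ∀ i, β ⟶ₘ α i) :
    (α ⟶ₘ A.X) →+ (β ⟶ₘ A.X) where
  toFun x := sub x h
  map_zero' := A.sub_zero h
  map_add' x y := A.sub_add x y h

variable {A} in
/-- Post-composition with a morphism of commutative monoids is additive. -/
def postHom {B : CMonObj M} (f : A ⟶ B) {a : ℕ} (α : Fin a → M) :
    (α ⟶ₘ A.X) →+ (α ⟶ₘ B.X) where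
  toFun x := sub f.hom (fun _ => x)
  map_zero' := CMonHom.map_zero f α
  map_add' := CMonHom.map_add f

/-- The underlying arrow of a morphism of commutative monoids, as an additive map. -/
def homHom (A B : CMonObj M) : (A ⟶ B) →+ ((fun _ : Fin 1 => A.X) ⟶ₘ B.X) where
  toFun f := f.hom
  map_zero' := CMonHom.zero_hom
  map_add' := CMonHom.add_hom

/-- The image under an fp-functor, as an additive map. -/
def mapHom {N : Type u'} [CartesianMulticategory.{v'} N] (F : FpFunctor M N) {a : ℕ}
    (α : Fin a → M) :
    (α ⟶ₘ A.X) →+ ((fun i => F.obj (α i)) ⟶ₘ (F.mapCMonObj A).X) where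
  toFun x := F.map x
  map_zero' := (F.map_sub A.one _).trans ((F.mapCMonObj A).sub_one _)
  map_add' x y := (F.map_sub A.mul ![x, y]).trans ((F.mapCMonObj A).sub_mul _)

/-- The arrow `(x₁, …, xₙ) ↦ f₁ x₁ + ⋯ + fₙ xₙ` given by morphisms of commutative monoids with the
same codomain. -/
def cotuple {n : ℕ} {X : Fin n → CMonObj M} {Z : CMonObj M} (f : ∀ i, X i ⟶ Z) :
    (fun i => (X i).X) ⟶ₘ Z.X :=
  ∑ i, act (β := fun i => (X i).X) (fun _ : Fin 1 => i) (fun _ => rfl) (f i).hom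

theorem sub_cotuple {n a : ℕ} {X : Fin n → CMonObj M} {Z : CMonObj M} (f : ∀ i, X i ⟶ Z)
    {α : Fin a → M} (x : ∀ i, α ⟶ₘ (X i).X) :
    sub (cotuple f) x = ∑ i, sub (f i).hom (fun _ => x i) :=
  (_root_.map_sum (Z.subHom x) _ _).trans (Finset.sum_congr rfl fun i _ =>
    sub_act (Y := fun i => (X i).X) (fun _ : Fin 1 => i) (f i).hom x)

theorem act_cotuple {n m : ℕ} {X : Fin n → CMonObj M} {Z : CMonObj M} (f : ∀ i, X i ⟶ Z)
    {β : Fin m → M} (p : Fin n → Fin m) (hp : ∀ i, β (p i) = (X i).X) :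
    act p hp (cotuple f) = ∑ i, act (fun _ : Fin 1 => p i) (fun _ => hp i) (f i).hom :=
  (_root_.map_sum (Z.actHom p hp) _ _).trans (Finset.sum_congr rfl fun _ _ =>
    act_act (β := fun i => (X i).X) _ _ _ _ _)

/-- Cotuples are compatible with composition, because post-composition with each `f i` is
additive. -/
theorem cotuple_comp {n : ℕ} {Y : Fin n → CMonObj M} {Z : CMonObj M} {k : Fin n → ℕ}
    {X : ∀ i, Fin (k i) → CMonObj M} (f : ∀ i, Y i ⟶ Z) (g : ∀ i j, X i j ⟶ Y i) :
    cotuple (X := concat X) (fun s => g (blk s) (pos s) ≫ f (blk s))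
      = comp (cotuple f) (fun i => cotuple (g i)) := by
  -- The `(i, j)`-th summand, as an arrow on the concatenated domain; indexing by pairs instead of
  -- positions makes the double sum over blocks available.
  let β : Fin (∑ i, k i) → M := concat fun i j => (X i j).X
  have hβ : ∀ i j, β (join i j) = (X i j).X := fun i j => concat_join _ i j
  let U : ∀ i, Fin (k i) → (β ⟶ₘ Z.X) := fun i j =>
    act (fun _ : Fin 1 => join i j) (fun _ => hβ i j) (g i j ≫ f i).hom
  have hU : cotuple (X := concat X) (fun s => g (blk s) (pos s) ≫ f (blk s))
      = ∑ s, U (blk s) (pos s) :=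
    Finset.sum_congr rfl fun s _ => act_congr _ _ _ fun _ => (join_blk_pos s).symm
  rw [hU, sum_join, comp_eq_sub, sub_cotuple]
  refine Finset.sum_congr rfl fun i _ => ?_
  rw [act_cotuple]
  refine Eq.trans ?_ (_root_.map_sum (postHom (f i) β) _ _).symm
  refine Finset.sum_congr rfl fun j _ => ?_
  rw [dep_join_eq U]
  refine (congrArg (act (β := β) (fun _ : Fin 1 => join i j) fun _ => hβ i j)
    (unaryComp_eq_sub (g i j).hom (f i).hom)).trans ?_
  exact act_sub _ _ _ _

theorem act_eqToHom_comp {A B C : CMonObj M} (h : A = B) (f : B ⟶ C) {m : ℕ} {β : Fin m → M}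
    (i : Fin m) (hA : β i = A.X) (hB : β i = B.X) :
    act (fun _ : Fin 1 => i) (fun _ => hA) (eqToHom h ≫ f).hom
      = act (fun _ : Fin 1 => i) (fun _ => hB) f.hom := by
  subst h
  rw [eqToHom_refl, Category.id_comp]

/-- Cotuples are compatible with the actions: the entries that `p` sends to `j` are summed. -/
theorem cotuple_sumAlong {n m : ℕ} {X : Fin n → CMonObj M} {Y : Fin m → CMonObj M}
    {Z : CMonObj M} (p : Fin n → Fin m) (hp : ∀ i, Y (p i) = X i) (f : ∀ i, X i ⟶ Z) :
    cotuple (sumAlong p hp f)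
      = act p (fun i => congrArg CMonObj.X (hp i)) (cotuple f) := by
  rw [act_cotuple]
  let φ : ∀ j, (Y j ⟶ Z) →+ ((fun j => (Y j).X) ⟶ₘ Z.X) := fun j =>
    (Z.actHom (β := fun j => (Y j).X) (fun _ : Fin 1 => j) (fun _ => rfl)).comp (homHom (Y j) Z)
  have h1 : cotuple (sumAlong p hp f) = ∑ j, ∑ i, φ j
      (if h : p i = j then eqToHom ((congrArg Y h.symm).trans (hp i)) ≫ f i else 0) :=
    Finset.sum_congr rfl fun j _ => _root_.map_sum (φ j) _ _
  -- After the interchange only the term `j = p i` survives in the inner sum.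
  rw [h1, Finset.sum_comm]
  refine Finset.sum_congr rfl fun i _ => ?_
  rw [Finset.sum_eq_single (p i)]
  · rw [dif_pos rfl]
    exact act_eqToHom_comp (β := fun j => (Y j).X) (hp i) (f i) (p i) rfl
      (congrArg CMonObj.X (hp i))
  · intro j _ hj
    rw [dif_neg hj.symm, _root_.map_zero]
  · simp

theorem cotuple_unary {A B : CMonObj M} (f : A ⟶ B) :
    cotuple (X := fun _ : Fin 1 => A) (fun _ => f) = f.hom :=
  (Fin.sum_univ_one _).trans (act_eq_self _ _ fun _ => Subsingleton.elim _ _)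

theorem cotuple_id_id : cotuple (X := fun _ : Fin 2 => A) (fun _ => 𝟙 A) = A.mul :=
  (Fin.sum_univ_two _).trans
    ((A.sub_mul (proj fun _ : Fin 2 => A.X)).symm.trans (sub_proj _))

theorem cotuple_nil (f : Fin 0 → (A ⟶ A)) : cotuple (X := fun _ : Fin 0 => A) f = A.one :=
  (A.sub_one (proj fun _ : Fin 0 => A.X)).symm.trans (sub_proj _)

end CMonObj

open CMonObj

/-- The counit of the adjunction: a sequence of morphisms of commutative monoids is sent to the
sum of its entries, each applied to its own variable. -/
def cotupleFunctor (M : Type u) [CartesianMulticategory.{v} M] :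
    FpFunctor (DiscreteCocone (CMonObj M)) M where
  obj A := CMonObj.X A
  map f := cotuple (M := M) f
  map_id A := cotuple_unary (CategoryStruct.id (obj := CMonObj M) A)
  map_comp f g := cotuple_comp (M := M) f g
  map_act p hp _ f := cotuple_sumAlong (M := M) p hp f

end Sums

/-! ### The canonical monoids of a discrete cocone multicategory -/

open CMonObj

section Unit

variable {C : Type u} [Category.{v} C] [CMonEnriched C]

attribute [local instance] CMonObj.homMonoid

theorem DiscreteCocone.sub_apply {n a : ℕ} {α : Fin a → C} {Y : Fin n → C} {Z : C}
    (f : ∀ i, Y i ⟶ Z) (g : ∀ i j, α j ⟶ Y i) (j : Fin a) :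
    sub (M := DiscreteCocone C) (α := α) (Y := Y) (Z := Z) f g j = ∑ i, g i j ≫ f i := by
  change sumAlong (C := C) (fun s : Fin (∑ _ : Fin n, a) => pos s) (fun _ => rfl)
    (fun s => g (blk s) (pos s) ≫ f (blk s)) j = _
  rw [sumAlong, sum_join]
  refine Finset.sum_congr rfl fun i _ => ?_
  rw [Finset.sum_eq_single j]
  · rw [dif_pos (pos_join_const i j)]
    refine (eqToHom_dep_join (k := fun _ : Fin n => a) (X := fun _ => α)
      (fun i j => g i j ≫ f i) i j _).trans ?_
    exact Category.id_comp _
  · intro b _ hb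
    rw [dif_neg]
    rwa [pos_join_const]
  · simp

/-- Every object of a preadditive category `C` is a commutative monoid in `C_▶`, with operation
`⟨1, 1⟩` and neutral element `⟨⟩`. -/
def canonicalMonoid (X : C) : CMonObj (DiscreteCocone C) where
  X := X
  mul _ := 𝟙 X
  one i := i.elim0
  mul_assoc := by
    refine cocone_arrow_ext _ _ rfl (fun _ => rfl) fun s => heq_of_eq ?_
    have h : ∀ {a b : ℕ} (f : ∀ _ : Fin a, X ⟶ X) (g : ∀ _ : Fin b, X ⟶ X)
        (_ : ∀ i, f i = 𝟙 X) (_ : ∀ i, g i = 𝟙 X) (i : Fin 2) (j : Fin (![a, b] i)),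
        pairHom (M := DiscreteCocone C) (X := X) f g i j ≫ 𝟙 X = 𝟙 X := by
      intro a b f g hf hg i j
      rw [Category.comp_id]
      match i, j with
      | 0, j => exact hf j
      | 1, j => exact hg j
    exact (h _ _ (fun _ => rfl) (fun _ => rfl) _ _).trans
      (h _ _ (fun _ => rfl) (fun _ => rfl) _ _).symm
  one_mul := by
    refine cocone_arrow_ext _ _ rfl (fun _ => rfl) fun s => heq_of_eq ?_
    refine Eq.symm ((Category.comp_id (obj := C) _).trans ?_)
    generalize blk _ = i, pos _ = j
    match i, j with
    | 0, j => exact j.elim0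
    | 1, j => rfl
  mul_one := by
    refine cocone_arrow_ext _ _ rfl (fun _ => rfl) fun s => heq_of_eq ?_
    refine Eq.symm ((Category.comp_id (obj := C) _).trans ?_)
    generalize blk _ = i, pos _ = j
    match i, j with
    | 0, j => rfl
    | 1, j => exact j.elim0
  mul_comm := by
    funext j
    change sumAlong (C := C) (X := fun _ : Fin 2 => X) (Y := fun _ : Fin 2 => X)
      (Equiv.swap 0 1) (fun _ => rfl) (fun _ => 𝟙 X) j = 𝟙 X
    rw [sumAlong, Fin.sum_univ_two]
    match j with
    | 0 => simp
    | 1 => simp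

/-- Every arrow of a preadditive category `C` is a morphism between the canonical commutative
monoids in `C_▶`. -/
def canonicalMonoidMap {X Y : C} (f : X ⟶ Y) : canonicalMonoid X ⟶ canonicalMonoid Y where
  hom _ := f
  map_mul := cocone_arrow_ext _ _ rfl (fun _ => rfl) fun _ =>
    heq_of_eq ((Category.comp_id f).trans (Category.id_comp f).symm)
  map_one := cocone_arrow_ext _ _ rfl (fun i => i.elim0) fun i => i.elim0

/-- The addition on the arrows of `C`, for objects regarded as objects of `C_▶`. -/
@[reducible] def DiscreteCocone.homAddCommMonoid (X Z : DiscreteCocone C) :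
    AddCommMonoid (Quiver.Hom (V := C) X Z) :=
  CMonEnriched.homAddCommMonoid (C := C) X Z

attribute [local instance] DiscreteCocone.homAddCommMonoid

theorem canonicalMonoid_add_apply {a : ℕ} {α : Fin a → C} {Z : C} (x y : ∀ i, α i ⟶ Z)
    (j : Fin a) : (canonicalMonoid Z).add (α := α) x y j = x j + y j := by
  refine (DiscreteCocone.sub_apply (Z := Z) _ _ j).trans ((Fin.sum_univ_two _).trans ?_)
  exact congrArg₂ (fun a b : α j ⟶ Z => a + b) (Category.comp_id _) (Category.comp_id _)

theorem canonicalMonoid_zero_apply {a : ℕ} (α : Fin a → C) (Z : C) (j : Fin a) :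
    (canonicalMonoid Z).zero α j = (0 : α j ⟶ Z) :=
  (DiscreteCocone.sub_apply (Z := Z) _ _ j).trans Finset.sum_empty

/-- Sums of arrows into a canonical monoid are computed entrywise. -/
def entryHom {a : ℕ} (α : Fin a → DiscreteCocone C) (Z : DiscreteCocone C) (j : Fin a) :
    (α ⟶ₘ (canonicalMonoid (C := C) Z).X) →+ (Quiver.Hom (V := C) (α j) Z) where
  toFun x := x j
  map_zero' := canonicalMonoid_zero_apply (C := C) α Z j
  map_add' x y := canonicalMonoid_add_apply (C := C) x y j

/-- The unit of the adjunction: objects and arrows of a preadditive category `C` as commutative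
monoids and their morphisms in `C_▶`. -/
def canonicalMonoidFunctor (C : Type u) [Category.{v} C] [CMonEnriched C] :
    AddFunctor C (CMonObj (DiscreteCocone C)) where
  obj := canonicalMonoid
  map := canonicalMonoidMap
  map_id _ := CMonHom.ext rfl
  map_comp f g := CMonHom.ext (Eq.symm
    ((unaryComp_eq_sub (canonicalMonoidMap f).hom (canonicalMonoidMap g).hom).trans
      (funext fun j => (DiscreteCocone.sub_apply (fun _ => g) (fun _ _ => f) j).trans
        (Fin.sum_univ_one _))))
  map_add {X _} f g := CMonHom.ext (funext fun j =>
    (canonicalMonoid_add_apply (α := fun _ : Fin 1 => X) (fun _ => f) (fun _ => g) j).symm)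
  map_zero X Y := CMonHom.ext (CMonHom.zero_hom.trans (funext fun j =>
    canonicalMonoid_zero_apply (fun _ : Fin 1 => X) Y j)).symm

/-- In `C_▶`, the arrow `⟨f₁, …, fₙ⟩` is the sum of its entries, each regarded as a morphism of
canonical monoids. -/
theorem cotuple_canonicalMonoidMap {n : ℕ} {X : Fin n → DiscreteCocone C} {Z : DiscreteCocone C}
    (f : X ⟶ₘ Z) :
    cotuple (fun i => canonicalMonoidMap (C := C) (f i)) = f := by
  funext j
  refine (_root_.map_sum (entryHom X Z j) (fun i => act (β := X) (fun _ : Fin 1 => i) (fun _ => rfl)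
    (canonicalMonoidMap (C := C) (f i)).hom) Finset.univ).trans ?_
  rw [Finset.sum_eq_single j]
  · change sumAlong (C := C) (X := fun _ : Fin 1 => X j) (Y := X) (fun _ : Fin 1 => j)
      (fun _ => rfl) (fun _ => f j) j = f j
    refine (Fin.sum_univ_one _).trans ((dif_pos rfl).trans ?_)
    exact Category.id_comp (obj := C) _
  · intro i _ hi
    change sumAlong (C := C) (X := fun _ : Fin 1 => X i) (Y := X) (fun _ : Fin 1 => i)
      (fun _ => rfl) (fun _ => f i) j = 0
    exact (Fin.sum_univ_one _).trans (dif_neg hi)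
  · simp

/-- An fp-functor out of `C_▶` is determined by its values on unary arrows. -/
theorem FpFunctor.map_eq_cotuple {M : Type u'} [CartesianMulticategory.{v'} M]
    (F : FpFunctor (DiscreteCocone C) M) {n : ℕ} {X : Fin n → DiscreteCocone C}
    {Z : DiscreteCocone C} (f : X ⟶ₘ Z) :
    F.map f = cotuple (fun i => F.mapCMonHom (canonicalMonoidMap (C := C) (f i))) := by
  refine (congrArg F.map (cotuple_canonicalMonoidMap f).symm).trans ?_
  refine (_root_.map_sum (mapHom (canonicalMonoid (C := C) Z) F X) _ _).trans ?_
  exact Finset.sum_congr rfl fun i _ => F.map_act _ _ _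

/-! ### The adjunction -/

theorem FpFunctor.map_cotuple {M : Type u} {N : Type u'} [CartesianMulticategory.{v} M]
    [CartesianMulticategory.{v'} N] (F : FpFunctor M N) {n : ℕ} {X : Fin n → CMonObj M}
    {Z : CMonObj M} (f : ∀ i, X i ⟶ Z) :
    F.map (cotuple f) = cotuple (fun i => F.mapCMonHom (f i)) := by
  refine (_root_.map_sum (mapHom Z F _) _ _).trans ?_
  exact Finset.sum_congr rfl fun i _ => F.map_act _ _ _

/-- Evaluating the canonical monoid structure on `A` in `cMon(M)_▶` recovers the monoid `A`. -/
theorem mapCMonObj_canonicalMonoid {M : Type u} [CartesianMulticategory.{v} M] (A : CMonObj M) :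
    (cotupleFunctor M).mapCMonObj (canonicalMonoid A) = A := by
  refine CMonObj.ext_heq rfl (heq_of_eq ?_) (heq_of_eq ?_)
  · exact cotuple_id_id A
  · exact cotuple_nil A fun _ => 𝟙 A

/-- The functor `(-)_▶` is left adjoint to `cMon(-)`. -/
def coconeAdjunction : coconeFunctor.{v, max u v} ⊣ cMonFunctor.{v, u} :=
  Adjunction.mkOfUnitCounit
    { unit :=
        { app := fun C => canonicalMonoidFunctor C.carrier
          naturality := fun C D F => AddFunctor.cMon_hext
            (fun X => CMonObj.ext_heq rfl
              (heq_of_eq (funext fun _ => (F.map_id X).symm))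
              (heq_of_eq (funext fun i : Fin 0 => i.elim0)))
            (fun f => HEq.rfl) }
      counit :=
        { app := fun M => cotupleFunctor M.carrier
          naturality := fun M N F => FpFunctor.hext rfl fun f =>
            heq_of_eq (FpFunctor.map_cotuple F f).symm }
      left_triangle := by
        ext C
        exact FpFunctor.hext rfl fun f => heq_of_eq (cotuple_canonicalMonoidMap (C := C.carrier) f)
      right_triangle := by
        ext M
        refine AddFunctor.cMon_hext (fun A => mapCMonObj_canonicalMonoid A) fun f => ?_
        exact heq_of_eq (cotuple_unary f) }

end Unit

/-! ### Fp-functors to sets as modules -/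

theorem set_sub_apply {n a : ℕ} {α : Fin a → Type w} {Y : Fin n → Type w} {Z : Type w}
    (f : Y ⟶ₘ Z) (g : ∀ i, α ⟶ₘ Y i) (x : ∀ i, α i) : sub f g x = f (fun i => g i x) := by
  refine congrArg f (funext fun i => congrArg (g i) (funext fun j => eq_of_heq ?_))
  refine (cast_heq _ _).trans ((cast_heq _ _).trans ?_)
  exact congr_arg_heq x (pos_join_const i j)

namespace CMonObj

variable (A : CMonObj (Type w))

/-- The commutative monoid, in the usual sense, given by a commutative monoid in `Set_×`. -/
@[reducible] def addCommMonoid : AddCommMonoid A.X :=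
  letI := A.homMonoid (fun i : Fin 0 => (i.elim0 : Type w))
  (Equiv.mk (fun a _ => a) (fun x => x fun i => i.elim0) (fun _ => rfl)
    (fun x => funext fun _ => congrArg x (funext fun i => i.elim0)) :
      A.X ≃ ((fun i : Fin 0 => (i.elim0 : Type w)) ⟶ₘ A.X)).addCommMonoid

attribute [local instance] addCommMonoid

theorem add_apply {a : ℕ} {α : Fin a → Type w} (x y : α ⟶ₘ A.X) (t : ∀ i, α i) :
    A.add x y t = x t + y t := by
  change _ = A.add (α := fun i : Fin 0 => (i.elim0 : Type w)) (fun _ => x t) (fun _ => y t)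
    fun i => i.elim0
  refine (set_sub_apply _ _ _).trans (Eq.trans ?_ (set_sub_apply _ _ _).symm)
  refine congrArg A.mul (funext fun i => ?_)
  match i with
  | 0 => rfl
  | 1 => rfl

theorem zero_apply {a : ℕ} (α : Fin a → Type w) (t : ∀ i, α i) : A.zero α t = 0 := by
  change _ = A.zero (fun i : Fin 0 => (i.elim0 : Type w)) fun i => i.elim0
  exact (set_sub_apply _ _ _).trans
    (Eq.trans (congrArg A.one (funext fun i => i.elim0)) (set_sub_apply _ _ _).symm)

attribute [local instance] homMonoid

/-- Evaluation at a point of functions into a commutative monoid. -/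
def evalHom {a : ℕ} {α : Fin a → Type w} (t : ∀ i, α i) : (α ⟶ₘ A.X) →+ A.X where
  toFun x := x t
  map_zero' := A.zero_apply α t
  map_add' x y := A.add_apply x y t

theorem cotuple_apply {n : ℕ} {X : Fin n → CMonObj (Type w)} (f : ∀ i, X i ⟶ A)
    (x : ∀ i, (X i).X) : cotuple f x = ∑ i, (f i).hom (fun _ => x i) :=
  _root_.map_sum (A.evalHom x) (fun i => act (β := fun i => (X i).X) (fun _ : Fin 1 => i)
    (fun _ => rfl) (f i).hom) Finset.univ

end CMonObj

attribute [local instance] CMonObj.addCommMonoid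

/-- A morphism of commutative monoids in `Set_×` as an additive map. -/
def CMonHom.toAddMonoidHom {A B : CMonObj (Type w)} (f : A ⟶ B) : A.X →+ B.X where
  toFun x := f.hom (fun _ => x)
  map_zero' := by
    have h := congrFun (CMonHom.map_zero f fun i : Fin 0 => (i.elim0 : Type w)) fun i => i.elim0
    rw [set_sub_apply] at h
    simpa only [CMonObj.zero_apply] using h
  map_add' x y := by
    have h := congrFun (CMonHom.map_add f (α := fun i : Fin 0 => (i.elim0 : Type w))
      (fun _ => x) (fun _ => y)) fun i => i.elim0
    rw [set_sub_apply] at h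
    simpa only [CMonObj.add_apply, set_sub_apply] using h

theorem CMonHom.comp_apply {A B C : CMonObj (Type w)} (f : A ⟶ B) (g : B ⟶ C) (x : A.X) :
    (f ≫ g).hom (fun _ => x) = g.hom (fun _ => f.hom fun _ => x) :=
  (congrFun (unaryComp_eq_sub f.hom g.hom) fun _ => x).trans (set_sub_apply _ _ _)

section Modules

variable {R : Type r} [Semiring R]

/-- The additive functor from the one-object category of a rig given by an fp-functor. -/
def FpFunctor.transpose (F : FpFunctor (DiscreteCocone (SingleObj R)) (Type w)) :
    AddFunctor (SingleObj R) (CMonObj (Type w)) where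
  obj X := F.mapCMonObj (canonicalMonoid X)
  map f := F.mapCMonHom (canonicalMonoidMap f)
  map_id X := (congrArg F.mapCMonHom ((canonicalMonoidFunctor (SingleObj R)).map_id X)).trans
    (F.mapCMon.map_id _)
  map_comp f g :=
    (congrArg F.mapCMonHom ((canonicalMonoidFunctor (SingleObj R)).map_comp f g)).trans
      (F.mapCMon.map_comp _ _)
  map_add f g :=
    (congrArg F.mapCMonHom ((canonicalMonoidFunctor (SingleObj R)).map_add f g)).trans
      (F.mapCMon.map_add _ _)
  map_zero X Y :=
    (congrArg F.mapCMonHom ((canonicalMonoidFunctor (SingleObj R)).map_zero X Y)).trans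
      (F.mapCMon.map_zero _ _)

/-- The module structure on the value of an additive functor from a rig to the commutative monoids
in `Set_×`. -/
@[reducible] def AddFunctor.module (G : AddFunctor (SingleObj R) (CMonObj (Type w))) :
    Module R (G.obj (SingleObj.star R)).X where
  smul c x := (G.map (X := SingleObj.star R) (Y := SingleObj.star R) c).hom fun _ => x
  one_smul x := congrFun (congrArg CMonHom.hom (G.map_id (SingleObj.star R))) fun _ => x
  mul_smul c d x :=
    (congrFun (congrArg CMonHom.hom (G.map_comp (X := SingleObj.star R) (Y := SingleObj.star R)
      (Z := SingleObj.star R) d c)) fun _ => x).trans (CMonHom.comp_apply _ _ x)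
  smul_zero c := (CMonHom.toAddMonoidHom
    (G.map (X := SingleObj.star R) (Y := SingleObj.star R) c)).map_zero
  smul_add c := (CMonHom.toAddMonoidHom
    (G.map (X := SingleObj.star R) (Y := SingleObj.star R) c)).map_add
  add_smul c d x :=
    (congrFun (congrArg CMonHom.hom (G.map_add (X := SingleObj.star R) (Y := SingleObj.star R)
      c d)) fun _ => x).trans (CMonObj.add_apply _ _ _ _)
  zero_smul x :=
    (congrFun ((congrArg CMonHom.hom (G.map_zero (SingleObj.star R) (SingleObj.star R))).trans
      CMonHom.zero_hom) fun _ => x).trans (CMonObj.zero_apply _ _ _)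

theorem moduleFunctor_obj_surjective : Function.Surjective (moduleFunctor.{w} R).obj := by
  intro F
  let G := F.transpose
  let := G.module
  refine ⟨SemimoduleCat.of R (G.obj (SingleObj.star R)).X, ?_⟩
  refine FpFunctor.hext rfl fun {n X Z} f => heq_of_eq (funext fun x => ?_)
  exact ((congrFun (F.map_eq_cotuple f) x).trans
    (CMonObj.cotuple_apply (F.mapCMonObj (canonicalMonoid (C := SingleObj R) Z)) _ x)).symm

theorem moduleFunctor_obj_injective : Function.Injective (moduleFunctor.{w} R).obj := by
  rintro ⟨E⟩ ⟨E'⟩ h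
  obtain rfl : E = E' := congrFun (congrArg (fun F => F.obj) h) (SingleObj.star R)
  rename_i i₁ m₁ i₂ m₂
  -- The two module structures have the same linear combinations.
  have hmap : ∀ {n : ℕ} (f : Fin n → R) (x : Fin n → E),
      (@Finset.sum _ _ i₁ Finset.univ fun i => m₁.smul (f i) (x i))
        = @Finset.sum _ _ i₂ Finset.univ fun i => m₂.smul (f i) (x i) := by
    intro n f x
    have key : ∀ {F G : FpFunctor (DiscreteCocone (SingleObj R)) (Type w)} (_ : F = G),
        F.map (X := fun _ : Fin n => SingleObj.star R) (Z := SingleObj.star R) f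
          ≍ G.map (X := fun _ : Fin n => SingleObj.star R) (Z := SingleObj.star R) f := by
      rintro F _ rfl
      rfl
    have h' := key h
    exact congrFun (eq_of_heq h') x
  obtain rfl : i₁ = i₂ := by
    refine AddCommMonoid.ext (funext fun x => funext fun y => ?_)
    have h2 := hmap (fun _ : Fin 2 => 1) ![x, y]
    rw [@Fin.sum_univ_two _ i₁, @Fin.sum_univ_two _ i₂] at h2
    have e₁ : ∀ z, m₁.smul 1 z = z := m₁.one_smul
    have e₂ : ∀ z, m₂.smul 1 z = z := m₂.one_smul
    simp only [e₁, e₂] at h2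
    exact h2
  obtain rfl : m₁ = m₂ := by
    refine Module.ext' _ _ fun c x => ?_
    have h1 := hmap (fun _ : Fin 1 => c) fun _ => x
    rwa [Fin.sum_univ_one, Fin.sum_univ_one] at h1
  rfl

instance moduleFunctor_faithful : (moduleFunctor.{w} R).Faithful where
  map_injective {E E'} φ ψ h := by
    refine SemimoduleCat.hom_ext (LinearMap.ext fun e => ?_)
    exact congrFun (congrFun (congrArg MultiNatTrans.app h) (SingleObj.star R)) fun _ => e

theorem MultiNatTrans.naturality_apply {M : Type u} [CartesianMulticategory.{v} M]
    {F G : FpFunctor M (Type w)} (τ : F ⟶ G) {n : ℕ} {X : Fin n → M} {Z : M} (f : X ⟶ₘ Z)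
    (x : ∀ i, F.obj (X i)) :
    τ.app Z (fun _ => F.map f x) = G.map f (fun i => τ.app (X i) fun _ => x i) := by
  have h := congrFun ((square_iff _ _ _ _).1 (τ.naturality f)) x
  rwa [set_sub_apply, set_sub_apply] at h

instance moduleFunctor_full : (moduleFunctor.{w} R).Full where
  map_surjective {E E'} τ := by
    -- Naturality at `⟨f₁, …, fₙ⟩` says that `τ` preserves the corresponding linear combinations.
    have hτ : ∀ {n : ℕ} (f : Fin n → R) (x : Fin n → E),
        (show E → E' from fun z => τ.app (SingleObj.star R) fun _ => z) (∑ i, f i • x i)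
          = ∑ i, f i • (show E' from τ.app (SingleObj.star R) fun _ => x i) := fun {n} f x =>
      MultiNatTrans.naturality_apply τ (X := fun _ : Fin n => SingleObj.star R)
        (Z := SingleObj.star R) f x
    let φ : E →ₗ[R] E' :=
      { toFun := fun x => τ.app (SingleObj.star R) fun _ => x
        map_add' := fun x y => by
          have h := hτ (fun _ => 1) ![x, y]
          simp only [Fin.sum_univ_two] at h
          have hx : (1 : R) • x + (1 : R) • y = x + y := by rw [one_smul, one_smul]
          exact (congrArg (fun z : E => τ.app (SingleObj.star R) fun _ => z) hx.symm).trans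
            (h.trans (congrArg₂ (fun a b : E' => a + b) (one_smul R _) (one_smul R _)))
        map_smul' := fun c x => by
          have h := hτ (fun _ => c) fun _ : Fin 1 => x
          rwa [Fin.sum_univ_one, Fin.sum_univ_one] at h }
    refine ⟨SemimoduleCat.ofHom φ, MultiNatTrans.ext (funext fun X => funext fun x => ?_)⟩
    exact congrArg (τ.app X) (funext fun i => congrArg x (Subsingleton.elim 0 i))

end Modules

end CartMult

/-- The functor `(-)_▶` from preadditive categories to cartesian multicategories is left adjoint to
the functor `cMon(-)` of commutative monoids. For every rig `R`, sending an `R`-module `E` to the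
fp-functor `R_▶ ⟶ Set_×` whose value at `⟨λ₁, …, λₙ⟩` is `(x₁, …, xₙ) ↦ λ₁ x₁ + ⋯ + λₙ xₙ` is a
fully faithful functor, bijective on objects, from `R`-modules to fp-functors `R_▶ ⟶ Set_×`. -/
theorem mainTheorem2 :
    Nonempty (CartMult.coconeFunctor.{v, max u v} ⊣ CartMult.cMonFunctor.{v, u}) ∧
    ∀ (R : Type r) [Semiring R],
      Function.Bijective (CartMult.moduleFunctor.{w} R).obj ∧
      (CartMult.moduleFunctor.{w} R).Full ∧ (CartMult.moduleFunctor.{w} R).Faithful :=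
  ⟨⟨CartMult.coconeAdjunction⟩, fun _ _ =>
    ⟨⟨CartMult.moduleFunctor_obj_injective, CartMult.moduleFunctor_obj_surjective⟩,
      CartMult.moduleFunctor_full, CartMult.moduleFunctor_faithful⟩⟩
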